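/- Let $s>1$ and, for $\varepsilon,\delta>0$, consider classical traveling waves $(\eta,u)(x,t)=(N(x-st),U(x-st))$ of the dissipative Peregrine–Boussinesq system $$\eta_t+u_x+(\eta u)_x=0,\qquad u_t+\eta_x+uu_x-\delta u_{xxt}-\varepsilon u_{xx}=0$$ with $(N,U)(\xi)\to(0,0)$ as $\xi\to+\infty$ and $(N,U)(\xi)\to(\eta_+,u_+)\neq(0,0)$ as $\xi\to-\infty$. Put $$\phi(u)=-su+\frac{u}{s-u}+\frac{u^2}{2},\quad c=\frac{\varepsilon}{\sqrt{s\delta}},\quad \alpha(s)=\frac{s-\sqrt{s^2+8}}2+\frac{4s}{(s-\sqrt{s^2+8})^2},\quad v(\tau)=U(-\sqrt{s\delta}\,\tau).$$ 1. (Reduction.) Necessarily $u_+=\frac{3s-\sqrt{s^2+8}}2$, $\eta_+=\frac{u_+}{s-u_+}$, $U<s$, $N=\frac{U}{s-U}$, and $v''+cv'+\phi(v)=0$. Let $\Phi(u)=\int_{u_+}^u\phi$ with this $u_+$. There is $u_s\in(u_+,s)$ with $\Phi(u_s)=\Phi(0)=:E_{\max}$ such that on $[0,u_s]$ the only zeros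 of $\phi$ are $0$ and $u_+$, $\phi<0$ on $(0,u_+)$, $\phi>0$ on $(u_+,u_s]$, $\phi'(0)<0<\phi'(u_+)=\alpha(s)$, $\Phi<E_{\max}$ on $(0,u_s)$, and $\Phi>0$ on $(0,u_s)\setminus\{u_+\}$. 2. (Length of the oscillations.) Let $0<E_m<E_{\max}$ and $E(\tau)=\frac12v'(\tau)^2+\Phi(v(\tau))$. There are $C,\kappa>0$ depending only on $s$ and $E_m$ such that for all $\varepsilon,\delta>0$ in the undular-bore regime $\varepsilon^2<4\delta s\alpha(s)$ and every such wave normalized by $v'(0)=0$ there is $T\in[0,C/c]$ with $E_m<E(\tau)<E_{\max}$ for $0<\tau<T$, and $0<E(\tau)<E_m$, $E(\tau)\le Ce^{-\kappa c(\tau-T)}$ for $\tau>T$. 3. (Limit shock.) The function equal to $(\eta_+,u_+)$ for $x<st$ and to $(0,0)$ for $x\ge st$ is a weak solution, on $t>0$, of the shallow-water equations $\eta_t+(u+\eta u)_x=0$, $u_t+(\eta+\frac{u^2}2)_x=0$, and is a classical shock of speed $s$: it satisfies the Rankine–Hugoniot conditions and the Lax inequalities $1<s<u_++\sqrt{1+\eta_+}$,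 $u_+-\sqrt{1+\eta_+}<s$. 4. (Convergence.) Let $\varepsilon,\delta\to0$ with $\delta=o(\varepsilon)$, and take any such traveling waves with these parameters. For each fixed $m\in(0,u_+)$, each wave has a translate with $U(0)=m$ and $U<m$ on $(0,\infty)$, and these translates converge to the shock of 3, with no restriction on the sign of $\varepsilon^2-4\delta s\alpha(s)$. If moreover $\varepsilon^2\le q\cdot4\delta s\alpha(s)$ for a fixed $q<1$, then $U$ attains its maximum at exactly one point, and the waves translated so that it is attained at $0$ converge to the same shock. In both cases convergence of $N(x-st)$ and $U(x-st)$ to the components of the shock means: uniformly on $\{(x,t):|x-st|\ge r\}$ for every $r>0$, and in $L^p(K)$ for every $1\le p<\infty$ and every compact $K\subset\mathbb R^2$. -/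

import Mathlib

open Filter Topology MeasureTheory
open scoped ENNReal

namespace PeregrineBoussinesq

noncomputable section

/-- Classical solutions `(η, u)`, functions of position `x` and time `t` in this order, of
`η_t + u_x + (η u)_x = 0`, `u_t + η_x + u u_x - δ u_xxt - ε u_xx = 0`. -/
structure IsSolution (ε δ : ℝ) (η u : ℝ → ℝ → ℝ) : Prop where
  smooth_eta : ContDiff ℝ 1 (fun p : ℝ × ℝ => η p.1 p.2)
  smooth_u : ContDiff ℝ 3 (fun p : ℝ × ℝ => u p.1 p.2)
  mass : ∀ x t, deriv (fun t' => η x t') t + deriv (fun y => u y t) x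
      + deriv (fun y => η y t * u y t) x = 0
  momentum : ∀ x t, deriv (fun t' => u x t') t + deriv (fun y => η y t) x
      + u x t * deriv (fun y => u y t) x
      - δ * deriv (fun t' => iteratedDeriv 2 (fun y => u y t') x) t
      - ε * iteratedDeriv 2 (fun y => u y t) x = 0

/-- `(N (x - s t), U (x - s t))` is a traveling wave of speed `s` which connects the state `(0, 0)`
ahead of the wave (`x - s t → +∞`) to the state `(ηp, up)` behind it (`x - s t → -∞`). -/
structure IsTravelingWave (s ε δ ηp up : ℝ) (N U : ℝ → ℝ) : Prop where
  solution : IsSolution ε δ (fun x t => N (x - s * t)) (fun x t => U (x - s * t))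
  eta_ahead : Tendsto N atTop (𝓝 0)
  u_ahead : Tendsto U atTop (𝓝 0)
  eta_behind : Tendsto N atBot (𝓝 ηp)
  u_behind : Tendsto U atBot (𝓝 up)

/-- The velocity behind the wave. -/
def uPlus (s : ℝ) : ℝ := (3 * s - √(s ^ 2 + 8)) / 2

/-- The elevation behind the wave. -/
def etaPlus (s : ℝ) : ℝ := uPlus s / (s - uPlus s)

/-- The undular bore regime is `ε ^ 2 < 4 * δ * s * alpha s`. -/
def alpha (s : ℝ) : ℝ := (s - √(s ^ 2 + 8)) / 2 + 4 * s / (s - √(s ^ 2 + 8)) ^ 2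

/-- The nonlinearity of the reduced equation `u'' + c u' + φ(u) = 0`. -/
def phi (s u : ℝ) : ℝ := -s * u + u / (s - u) + u ^ 2 / 2

/-- The friction coefficient `c = ε / √(s δ)`. -/
def friction (s ε δ : ℝ) : ℝ := ε / √(s * δ)

/-- The velocity profile as a function of `τ = -(x - s t) / √(s δ)`. -/
def profile (s δ : ℝ) (U : ℝ → ℝ) (τ : ℝ) : ℝ := U (-(√(s * δ) * τ))

/-- The primitive of `f` which vanishes at `up`. -/
def potential (f : ℝ → ℝ) (up u : ℝ) : ℝ := ∫ z in up..u, f z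

/-- The energy `w ^ 2 / 2 + Φ(v)` with `w = v'`, `Φ' = φ`, `Φ(uPlus s) = 0`. -/
def energy (s : ℝ) (v : ℝ → ℝ) (τ : ℝ) : ℝ :=
  deriv v τ ^ 2 / 2 + potential (phi s) (uPlus s) (v τ)

/-- The shape of the potential well between a saddle `um`, a center `up` and the point `us` at the
height of the saddle on the other side of the well. -/
structure IsWell (f : ℝ → ℝ) (um up us : ℝ) : Prop where
  lt_center : um < up
  lt_end : up < us
  zero_iff : ∀ u ∈ Set.Icc um us, f u = 0 ↔ u = um ∨ u = up
  potential_pos : ∀ u ∈ Set.Ioo um us, u ≠ up → 0 < potential f up u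
  potential_lt : ∀ u ∈ Set.Ioo um us, potential f up u < potential f up um
  potential_end : potential f up us = potential f up um
  neg : ∀ u ∈ Set.Ioo um up, f u < 0
  pos : ∀ u ∈ Set.Ioc up us, 0 < f u
  deriv_saddle : deriv f um < 0
  deriv_center : 0 < deriv f up

/-- Weak solutions on `t > 0` of the shallow-water equations
`η_t + (u + η u)_x = 0`, `u_t + (η + u ^ 2 / 2)_x = 0`. -/
structure IsShallowWaterWeakSolution (η u : ℝ → ℝ → ℝ) : Prop where
  eta_loc : LocallyIntegrableOn (fun p : ℝ × ℝ => η p.1 p.2) {p | 0 < p.2}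
  u_loc : LocallyIntegrableOn (fun p : ℝ × ℝ => u p.1 p.2) {p | 0 < p.2}
  eta_u_loc : LocallyIntegrableOn (fun p : ℝ × ℝ => η p.1 p.2 * u p.1 p.2) {p | 0 < p.2}
  u_sq_loc : LocallyIntegrableOn (fun p : ℝ × ℝ => u p.1 p.2 ^ 2) {p | 0 < p.2}
  mass : ∀ ψ : ℝ × ℝ → ℝ, ContDiff ℝ (⊤ : ℕ∞) ψ → HasCompactSupport ψ →
    tsupport ψ ⊆ {p | 0 < p.2} →
    ∫ p : ℝ × ℝ, (η p.1 p.2 * fderiv ℝ ψ p (0, 1)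
      + (u p.1 p.2 + η p.1 p.2 * u p.1 p.2) * fderiv ℝ ψ p (1, 0)) = 0
  momentum : ∀ ψ : ℝ × ℝ → ℝ, ContDiff ℝ (⊤ : ℕ∞) ψ → HasCompactSupport ψ →
    tsupport ψ ⊆ {p | 0 < p.2} →
    ∫ p : ℝ × ℝ, (u p.1 p.2 * fderiv ℝ ψ p (0, 1)
      + (η p.1 p.2 + u p.1 p.2 ^ 2 / 2) * fderiv ℝ ψ p (1, 0)) = 0

/-- The jump from the left value `a` to the right value `b` along the line `x = s t`. -/
def jump (s a b x t : ℝ) : ℝ := if x < s * t then a else b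

/-- A shock of the shallow-water equations of the faster characteristic family, with left state
`(ηl, ul)`, right state `(ηr, ur)` and speed `s`: the Rankine-Hugoniot conditions and the Lax
entropy inequalities for the characteristic speeds `u ± √(1 + η)`. -/
structure IsLaxShock (s ηl ul ηr ur : ℝ) : Prop where
  ne : (ηl, ul) ≠ (ηr, ur)
  hyperbolic_left : 0 < 1 + ηl
  hyperbolic_right : 0 < 1 + ηr
  mass : s * (ηr - ηl) = (ur + ηr * ur) - (ul + ηl * ul)
  momentum : s * (ur - ul) = (ηr + ur ^ 2 / 2) - (ηl + ul ^ 2 / 2)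
  fast_right : ur + √(1 + ηr) < s
  fast_left : s < ul + √(1 + ηl)
  slow_left : ul - √(1 + ηl) < s

/-- Strong convergence of waves `F i (x - s t)` to the jump from `a` to `b`: uniformly at any
positive distance from the discontinuity, and in `L^p_loc` of the space-time plane for all finite
`p`. -/
structure ConvergesToJump {ι : Type*} (l : Filter ι) (s a b : ℝ) (F : ι → ℝ → ℝ) : Prop where
  uniform : ∀ r : ℝ, 0 < r →
    TendstoUniformlyOn (fun i (p : ℝ × ℝ) => F i (p.1 - s * p.2))
      (fun p => jump s a b p.1 p.2) l {p | r ≤ |p.1 - s * p.2|}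
  local_Lp : ∀ p : ℝ≥0∞, 1 ≤ p → p ≠ ⊤ → ∀ K : Set (ℝ × ℝ), IsCompact K →
    Tendsto (fun i => eLpNorm
      (fun q : ℝ × ℝ => F i (q.1 - s * q.2) - jump s a b q.1 q.2) p (volume.restrict K)) l (𝓝 0)

end

end PeregrineBoussinesq

/-!
A traveling wave satisfies two first integrals: the mass equation gives `N (s - U) = U`, hence
`U < s` and `N = U / (s - U)`, and the momentum equation gives `s δ U'' - ε U' + φ(U) = 0`. The
constants of integration vanish because, for a function `f` which converges at infinity,
`a f'' - b f'` cannot tend to a nonzero limit there (`eq_zero_of_near_const`); the same remark at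
`-∞` makes the state behind the wave a zero of `φ`. Thus `v(τ) = U(-√(s δ) τ)` is an orbit of the
damped oscillator `v'' + c v' + φ(v) = 0` from the saddle `0` to the minimum `u₊` of the potential
`Φ` (`IsProfile`). The energy `E = v' ^ 2 / 2 + Φ(v)` strictly decreases from `Φ(0)` to `0`, which
confines the orbit to the potential well (`exists_isWell`).

All quantitative statements rest on estimates which are uniform in the friction `c`:

* On the front, `v' ≥ β v` with `β` of order `1 / (1 + c)` (`IsProfile.front_velocity`). So the
  front decays exponentially ahead of the wave, and crossing it dissipates an energy of order
  `c / (1 + c)`.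
* From then on, the time until the energy is below a given level is at most of order `c + 1 / c`
  (`exists_duration_bound`). The difficulty is that each oscillation may pass close to the saddle,
  where the motion is slow. With `D = Φ(0) - E`, so that `D' = c v' ^ 2`, and `g(v) = -φ(v) / v`,
  the function `v' g(v) / √D` has a derivative which is bounded below near the saddle, because
  `√D` is at most of order `v` there; all remaining terms are dominated by multiples of `D'` by
  functions of `D`, and integrate to at most `O(c + 1 / c)`.
* Below the level of the saddle the energy decays exponentially (`exists_decay`).
* If `c ^ 2 ≤ 4 q α(s)` with `q < 1`, Sturm comparison at `u₊` shows that the orbit overshoots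
  `u₊`, and that the time from the front to the crest is also of order `c + 1 / c`
  (`exists_front_to_crest`).

In the variable `ξ = x - s t` a time of order `c + 1 / c` becomes a length of order
`√(s δ) (c + 1 / c) = ε + s δ / ε`, which tends to zero when `ε → 0` and `δ = o(ε)`. This gives
uniform convergence away from the shock (`convergesToJump_of_nearJump`), and convergence in `L^p`
on compact sets since the waves are uniformly bounded and the line `x = s t` is a null set. The
limit is a weak solution because the jump is constant in the direction `(s, 1)` and the
Rankine-Hugoniot conditions turn both equations into a derivative in this direction.
-/

namespace PeregrineBoussinesq

noncomputable section

/-! ### The potential well -/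

/-- The positive factor in `φ(u) = u (u - u₊) k(u)`; it is at least `1 / 2` left of `s`. -/
def stiffness (s u : ℝ) : ℝ := 1 / 2 + (s + √(s ^ 2 + 8)) / (4 * (s - u))

/-- The quotient `-φ(u) / u`, positive on `[0, u₊)`. -/
def restoring (s u : ℝ) : ℝ := (uPlus s - u) * stiffness s u

/-- `Φ`, the primitive of `φ` which vanishes at `u₊`. -/
abbrev wellPotential (s u : ℝ) : ℝ := potential (phi s) (uPlus s) u

lemma sqrt_bounds {s : ℝ} (hs : 1 < s) :
    s < √(s ^ 2 + 8) ∧ √(s ^ 2 + 8) < s + 2 ∧ √(s ^ 2 + 8) < 3 * s ∧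
      √(s ^ 2 + 8) ^ 2 = s ^ 2 + 8 := by
  refine ⟨Real.lt_sqrt_of_sq_lt (by linarith), ?_, ?_, Real.sq_sqrt (by positivity)⟩
  · rw [Real.sqrt_lt' (by linarith)]; nlinarith
  · rw [Real.sqrt_lt' (by linarith)]; nlinarith

lemma uPlus_pos {s : ℝ} (hs : 1 < s) : 0 < uPlus s := by
  have := sqrt_bounds hs; unfold uPlus; linarith

lemma uPlus_lt {s : ℝ} (hs : 1 < s) : uPlus s < s := by
  have := sqrt_bounds hs; unfold uPlus; linarith

lemma sub_uPlus_lt_one {s : ℝ} (hs : 1 < s) : s - uPlus s < 1 := by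
  have := sqrt_bounds hs; unfold uPlus; linarith

lemma phi_eq {s u : ℝ} (hs : 1 < s) (hu : u < s) :
    phi s u = u * (u - uPlus s) * stiffness s u := by
  have h := (sqrt_bounds hs).2.2.2
  have : s - u ≠ 0 := by linarith
  unfold phi uPlus stiffness
  generalize √(s ^ 2 + 8) = q at *
  field_simp
  linear_combination (-2 * u) * h

lemma phi_eq_restoring {s u : ℝ} (hs : 1 < s) (hu : u < s) :
    phi s u = -(u * restoring s u) := by
  rw [phi_eq hs hu, restoring]; ring

lemma half_le_stiffness {s u : ℝ} (hs : 1 < s) (hu : u < s) : 1 / 2 ≤ stiffness s u := by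
  have h : 0 < s - u := by linarith
  unfold stiffness
  have : 0 ≤ (s + √(s ^ 2 + 8)) / (4 * (s - u)) := by positivity
  linarith

lemma stiffness_mono {s u u' : ℝ} (hs : 1 < s) (huu : u ≤ u') (hu : u' < s) :
    stiffness s u ≤ stiffness s u' := by
  have h : 0 < s - u' := by linarith
  unfold stiffness
  gcongr

lemma hasDerivAt_phi {s u : ℝ} (hu : u < s) :
    HasDerivAt (phi s) (-s + s / (s - u) ^ 2 + u) u := by
  have h : s - u ≠ 0 := by linarith
  have h1 : HasDerivAt (fun u : ℝ => s - u) (-1) u := by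
    simpa using (hasDerivAt_id u).const_sub s
  have := (((hasDerivAt_id u).const_mul (-s)).add ((hasDerivAt_id u).div h1 h)).add
    (((hasDerivAt_id u).pow 2).div_const 2)
  refine this.congr_deriv ?_
  simp only [id]
  field_simp
  ring

lemma continuousOn_phi {s : ℝ} : ContinuousOn (phi s) (Set.Iio s) :=
  fun _ hu => (hasDerivAt_phi hu).continuousAt.continuousWithinAt

lemma hasDerivAt_primitive {s u : ℝ} (hu : u < s) :
    HasDerivAt (fun u => -s * u ^ 2 / 2 - u - s * Real.log (s - u) + u ^ 3 / 6) (phi s u) u := by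
  have h : s - u ≠ 0 := by linarith
  have h1 : HasDerivAt (fun u : ℝ => s - u) (-1) u := by
    simpa using (hasDerivAt_id u).const_sub s
  have := (((((hasDerivAt_id u).pow 2).const_mul (-s)).div_const 2).sub (hasDerivAt_id u)).sub
    ((h1.log h).const_mul s) |>.add (((hasDerivAt_id u).pow 3).div_const 6)
  refine this.congr_deriv ?_
  simp only [id, phi]
  field_simp
  ring

lemma wellPotential_eq {s u : ℝ} (hs : 1 < s) (hu : u < s) :
    wellPotential s u = (-s * u ^ 2 / 2 - u - s * Real.log (s - u) + u ^ 3 / 6) -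
      (-s * uPlus s ^ 2 / 2 - uPlus s - s * Real.log (s - uPlus s) + uPlus s ^ 3 / 6) := by
  have hsub : Set.uIcc (uPlus s) u ⊆ Set.Iio s := fun x hx =>
    lt_of_le_of_lt hx.2 (max_lt (uPlus_lt hs) hu)
  exact intervalIntegral.integral_eq_sub_of_hasDerivAt
    (fun x hx => hasDerivAt_primitive (hsub hx)) (continuousOn_phi.mono hsub).intervalIntegrable

lemma hasDerivAt_wellPotential {s u : ℝ} (hs : 1 < s) (hu : u < s) :
    HasDerivAt (wellPotential s) (phi s u) u := by
  refine ((hasDerivAt_primitive hu).sub_const (-s * uPlus s ^ 2 / 2 - uPlus s -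
    s * Real.log (s - uPlus s) + uPlus s ^ 3 / 6)).congr_of_eventuallyEq ?_
  filter_upwards [Iio_mem_nhds hu] with x hx using wellPotential_eq hs hx

lemma wellPotential_uPlus (s : ℝ) : wellPotential s (uPlus s) = 0 :=
  intervalIntegral.integral_same

lemma continuousOn_wellPotential {s : ℝ} (hs : 1 < s) :
    ContinuousOn (wellPotential s) (Set.Iio s) :=
  fun _ hu => (hasDerivAt_wellPotential hs hu).continuousAt.continuousWithinAt

lemma phi_neg {s u : ℝ} (hs : 1 < s) (h0 : 0 < u) (hu : u < uPlus s) : phi s u < 0 := by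
  have hus := hu.trans (uPlus_lt hs)
  rw [phi_eq hs hus]
  have := half_le_stiffness hs hus
  exact mul_neg_of_neg_of_pos (mul_neg_of_pos_of_neg h0 (by linarith)) (by linarith)

lemma phi_pos {s u : ℝ} (hs : 1 < s) (h0 : uPlus s < u) (hu : u < s) : 0 < phi s u := by
  rw [phi_eq hs hu]
  have := half_le_stiffness hs hu
  have := uPlus_pos hs
  exact mul_pos (mul_pos (by linarith) (by linarith)) (by linarith)

lemma phi_eq_zero_iff {s u : ℝ} (hs : 1 < s) (hu : u < s) :
    phi s u = 0 ↔ u = 0 ∨ u = uPlus s := by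
  have := half_le_stiffness hs hu
  have h : stiffness s u ≠ 0 := by linarith
  rw [phi_eq hs hu]
  simp [h, sub_eq_zero]

lemma wellPotential_strictAntiOn {s : ℝ} (hs : 1 < s) :
    StrictAntiOn (wellPotential s) (Set.Icc 0 (uPlus s)) := by
  have hlt := uPlus_lt hs
  refine strictAntiOn_of_deriv_neg (convex_Icc _ _)
    ((continuousOn_wellPotential hs).mono fun x hx => lt_of_le_of_lt hx.2 hlt) fun x hx => ?_
  rw [interior_Icc] at hx
  rw [(hasDerivAt_wellPotential hs (hx.2.trans hlt)).deriv]
  exact phi_neg hs hx.1 hx.2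

lemma wellPotential_strictMonoOn {s : ℝ} (hs : 1 < s) :
    StrictMonoOn (wellPotential s) (Set.Ico (uPlus s) s) := by
  refine strictMonoOn_of_deriv_pos (convex_Ico _ _)
    ((continuousOn_wellPotential hs).mono fun x hx => hx.2) fun x hx => ?_
  rw [interior_Ico] at hx
  rw [(hasDerivAt_wellPotential hs hx.2).deriv]
  exact phi_pos hs hx.1 hx.2

lemma wellPotential_zero_pos {s : ℝ} (hs : 1 < s) : 0 < wellPotential s 0 := by
  have h := uPlus_pos hs
  have := wellPotential_strictAntiOn hs ⟨le_rfl, h.le⟩ ⟨h.le, le_rfl⟩ h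
  rwa [wellPotential_uPlus] at this

/-- `α(s)` is the slope of `φ` at `u₊`, and equals `u₊ k(u₊)`. -/
lemma alpha_eq_deriv {s : ℝ} (hs : 1 < s) : alpha s = deriv (phi s) (uPlus s) := by
  rw [(hasDerivAt_phi (uPlus_lt hs)).deriv]
  have h := sqrt_bounds hs
  have h1 : s - uPlus s = -(s - √(s ^ 2 + 8)) / 2 := by unfold uPlus; ring
  have h2 : s - √(s ^ 2 + 8) ≠ 0 := by linarith
  rw [h1]
  unfold alpha uPlus
  field_simp
  ring

lemma alpha_eq_stiffness {s : ℝ} (hs : 1 < s) : alpha s = uPlus s * stiffness s (uPlus s) := by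
  have h := sqrt_bounds hs
  have h2 : s - √(s ^ 2 + 8) ≠ 0 := by linarith
  have h3 : √(s ^ 2 + 8) - s ≠ 0 := by linarith
  have h1 : s - uPlus s = (√(s ^ 2 + 8) - s) / 2 := by unfold uPlus; ring
  unfold stiffness
  rw [h1]
  unfold alpha uPlus
  have h4 := h.2.2.2
  generalize √(s ^ 2 + 8) = q at *
  have : (s - q) ^ 2 = (q - s) ^ 2 := by ring
  rw [this]
  field_simp
  linear_combination (-8 * s) * h4

lemma alpha_pos {s : ℝ} (hs : 1 < s) : 0 < alpha s := by
  rw [alpha_eq_stiffness hs]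
  have := half_le_stiffness hs (uPlus_lt hs)
  exact mul_pos (uPlus_pos hs) (by linarith)

/-- The potential is unbounded at `s`, so it climbs back to the height of the saddle. -/
lemma exists_isWell {s : ℝ} (hs : 1 < s) :
    ∃ us, us < s ∧ IsWell (phi s) 0 (uPlus s) us := by
  have h0 := uPlus_pos hs
  have hlt := uPlus_lt hs
  have hlog : Tendsto (fun u : ℝ => -s * Real.log (s - u)) (𝓝[<] s) atTop := by
    have h1 : Tendsto (fun u : ℝ => s - u) (𝓝[<] s) (𝓝[>] 0) := by
      refine tendsto_nhdsWithin_iff.2 ⟨?_, ?_⟩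
      · have : Tendsto (fun u : ℝ => s - u) (𝓝 s) (𝓝 (s - s)) :=
          (continuous_const.sub continuous_id).tendsto s
        rw [sub_self] at this
        exact this.mono_left nhdsWithin_le_nhds
      · filter_upwards [self_mem_nhdsWithin] with x hx using sub_pos.2 (Set.mem_Iio.1 hx)
    exact (Real.tendsto_log_nhdsGT_zero.comp h1).const_mul_atBot_of_neg (by linarith)
  have hcont : Tendsto (fun u : ℝ => -s * u ^ 2 / 2 - u + u ^ 3 / 6) (𝓝[<] s)
      (𝓝 (-s * s ^ 2 / 2 - s + s ^ 3 / 6)) :=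
    (Continuous.tendsto (by fun_prop) s).mono_left nhdsWithin_le_nhds
  have hbig := (hcont.add_atTop hlog).eventually_gt_atTop (wellPotential s 0 +
      (-s * uPlus s ^ 2 / 2 - uPlus s - s * Real.log (s - uPlus s) + uPlus s ^ 3 / 6))
  obtain ⟨u1, hu1, hu1p, hu1s⟩ :=
    (hbig.and (Ioo_mem_nhdsLT hlt)).exists
  have hval : wellPotential s 0 < wellPotential s u1 := by
    rw [wellPotential_eq hs hu1s]; linarith
  have hpos := wellPotential_zero_pos hs
  obtain ⟨us, ⟨hus1, hus2⟩, hus⟩ := intermediate_value_Icc hu1p.le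
    ((continuousOn_wellPotential hs).mono fun x hx => lt_of_le_of_lt hx.2 hu1s)
    (show wellPotential s 0 ∈ Set.Icc (wellPotential s (uPlus s)) (wellPotential s u1) from
      ⟨by rw [wellPotential_uPlus]; exact hpos.le, hval.le⟩)
  have hus_lt : us < s := lt_of_le_of_lt hus2 hu1s
  have hus_gt : uPlus s < us := by
    refine lt_of_le_of_ne hus1 fun h => ?_
    rw [← h, wellPotential_uPlus] at hus
    linarith
  refine ⟨us, hus_lt, h0, hus_gt, ?_, ?_, ?_, hus, fun u hu => phi_neg hs hu.1 hu.2,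
    fun u hu => phi_pos hs hu.1 (lt_of_le_of_lt hu.2 hus_lt), ?_, ?_⟩
  · exact fun u hu => phi_eq_zero_iff hs (lt_of_le_of_lt hu.2 hus_lt)
  · intro u hu hne
    rw [← wellPotential_uPlus s]
    rcases lt_or_gt_of_ne hne with h | h
    · exact wellPotential_strictAntiOn hs ⟨hu.1.le, h.le⟩ ⟨h0.le, le_rfl⟩ h
    · exact wellPotential_strictMonoOn hs ⟨le_rfl, hlt⟩ ⟨h.le, hu.2.trans hus_lt⟩ h
  · intro u hu
    rcases le_or_gt u (uPlus s) with h | h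
    · exact wellPotential_strictAntiOn hs ⟨le_rfl, h0.le⟩ ⟨hu.1.le, h⟩ hu.1
    · exact lt_of_lt_of_eq (wellPotential_strictMonoOn hs ⟨h.le, hu.2.trans hus_lt⟩
        ⟨hus_gt.le, hus_lt⟩ hu.2) hus
  · rw [(hasDerivAt_phi (show (0 : ℝ) < s by linarith)).deriv]
    have : s / (s - 0) ^ 2 < s := by
      rw [sub_zero, div_lt_iff₀ (by positivity)]
      nlinarith [mul_pos (show 0 < s by linarith) (show 0 < s - 1 by linarith), sq_nonneg s]
    linarith
  · rw [← alpha_eq_deriv hs]; exact alpha_pos hs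

lemma wellPotential_nonneg {s u : ℝ} (hs : 1 < s) (h0 : 0 ≤ u) (hu : u < s) :
    0 ≤ wellPotential s u := by
  rw [← wellPotential_uPlus s]
  rcases le_total u (uPlus s) with h | h
  · exact (wellPotential_strictAntiOn hs).antitoneOn ⟨h0, h⟩ ⟨(uPlus_pos hs).le, le_rfl⟩ h
  · exact (wellPotential_strictMonoOn hs).monotoneOn ⟨le_rfl, uPlus_lt hs⟩ ⟨h, hu⟩ h

/-- A function on an interval whose derivative has the sign of `u - e` is smallest at `e`. -/
lemma le_of_deriv_sign {f f' : ℝ → ℝ} {a b e : ℝ} (he : e ∈ Set.Icc a b)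
    (hf : ∀ x ∈ Set.Icc a b, HasDerivAt f (f' x) x)
    (hsign : ∀ x ∈ Set.Icc a b, 0 ≤ f' x * (x - e)) {x : ℝ} (hx : x ∈ Set.Icc a b) :
    f e ≤ f x := by
  rcases le_total x e with h | h
  · have hsub : Set.Icc x e ⊆ Set.Icc a b := Set.Icc_subset_Icc hx.1 he.2
    refine antitoneOn_of_deriv_nonpos (convex_Icc x e)
      (fun y hy => (hf y (hsub hy)).continuousAt.continuousWithinAt)
      (fun y hy => (hf y (hsub (interior_subset hy))).differentiableAt.differentiableWithinAt)
      (fun y hy => ?_) ⟨le_rfl, h⟩ ⟨h, le_rfl⟩ h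
    have hy' := hsub (interior_subset hy)
    rw [interior_Icc] at hy
    rw [(hf y hy').deriv]
    have := hsign y hy'
    by_contra hc
    push Not at hc
    nlinarith [mul_pos hc (sub_pos.2 hy.2)]
  · have hsub : Set.Icc e x ⊆ Set.Icc a b := Set.Icc_subset_Icc he.1 hx.2
    refine monotoneOn_of_deriv_nonneg (convex_Icc e x)
      (fun y hy => (hf y (hsub hy)).continuousAt.continuousWithinAt)
      (fun y hy => (hf y (hsub (interior_subset hy))).differentiableAt.differentiableWithinAt)
      (fun y hy => ?_) ⟨le_rfl, h⟩ ⟨h, le_rfl⟩ h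
    have hy' := hsub (interior_subset hy)
    rw [interior_Icc] at hy
    rw [(hf y hy').deriv]
    have := hsign y hy'
    by_contra hc
    push Not at hc
    nlinarith [mul_pos (neg_pos.2 hc) (sub_pos.2 hy.1)]

/-- Near the saddle the depth of the well is at most quadratic. -/
lemma depth_le {s us u : ℝ} (hs : 1 < s) (hus : us < s) (hu : u ∈ Set.Icc 0 us) :
    wellPotential s 0 - wellPotential s u ≤ uPlus s * stiffness s us / 2 * u ^ 2 := by
  have key := le_of_deriv_sign (f := fun u => uPlus s * stiffness s us / 2 * u ^ 2 +
    wellPotential s u) (f' := fun u => uPlus s * stiffness s us * u + phi s u)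
    (a := 0) (b := us) (e := 0) ⟨le_rfl, hu.1.trans hu.2⟩ ?_ ?_ hu
  · simp only [ne_eq, OfNat.ofNat_ne_zero, not_false_eq_true, zero_pow, mul_zero, zero_add] at key
    linarith
  · intro x hx
    have := ((hasDerivAt_id x).pow 2).const_mul (uPlus s * stiffness s us / 2) |>.add
      (hasDerivAt_wellPotential hs (lt_of_le_of_lt hx.2 hus))
    refine this.congr_deriv ?_
    simp only [id]; ring
  · intro x hx
    have hxs := lt_of_le_of_lt hx.2 hus
    rw [phi_eq hs hxs]
    have h1 := stiffness_mono hs hx.2 hus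
    have h2 := half_le_stiffness hs hxs
    have h3 := uPlus_pos hs
    have : (uPlus s * stiffness s us * x + x * (x - uPlus s) * stiffness s x) * (x - 0) =
      x ^ 2 * (uPlus s * (stiffness s us - stiffness s x) + x * stiffness s x) := by ring
    rw [this]
    have h4 : 0 ≤ uPlus s * (stiffness s us - stiffness s x) :=
      mul_nonneg h3.le (by linarith)
    have h5 : 0 ≤ x * stiffness s x := mul_nonneg hx.1 (by linarith)
    positivity

lemma wellPotential_le {s us u : ℝ} (hs : 1 < s) (hus : us < s) (hus' : uPlus s ≤ us)
    (hu : u ∈ Set.Icc 0 us) :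
    wellPotential s u ≤ us * stiffness s us / 2 * (u - uPlus s) ^ 2 := by
  have key := le_of_deriv_sign (f := fun u => us * stiffness s us / 2 * (u - uPlus s) ^ 2 -
    wellPotential s u) (f' := fun u => us * stiffness s us * (u - uPlus s) - phi s u)
    (a := 0) (b := us) (e := uPlus s) ⟨(uPlus_pos hs).le, hus'⟩ ?_ ?_ hu
  · rw [wellPotential_uPlus] at key
    simp only [sub_self, ne_eq, OfNat.ofNat_ne_zero, not_false_eq_true, zero_pow, mul_zero] at key
    linarith
  · intro x hx
    have := (((hasDerivAt_id x).sub_const (uPlus s)).pow 2).const_mul (us * stiffness s us / 2)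
      |>.sub (hasDerivAt_wellPotential hs (lt_of_le_of_lt hx.2 hus))
    refine this.congr_deriv ?_
    simp only [id]; ring
  · intro x hx
    have hxs := lt_of_le_of_lt hx.2 hus
    rw [phi_eq hs hxs]
    have h1 := stiffness_mono hs hx.2 hus
    have h2 := half_le_stiffness hs hxs
    have : (us * stiffness s us * (x - uPlus s) - x * (x - uPlus s) * stiffness s x) *
        (x - uPlus s) = (x - uPlus s) ^ 2 * (us * stiffness s us - x * stiffness s x) := by ring
    rw [this]
    have h5 : x * stiffness s x ≤ us * stiffness s us := by
      have := hx.1; have := hx.2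
      gcongr
      linarith
    exact mul_nonneg (sq_nonneg _) (by linarith)

lemma le_wellPotential {s us va u : ℝ} (hs : 1 < s) (hus : us < s) (hus' : uPlus s ≤ us)
    (hva : 0 < va) (hva' : va ≤ uPlus s) (hu : u ∈ Set.Icc va us) :
    va / 4 * (u - uPlus s) ^ 2 ≤ wellPotential s u := by
  have key := le_of_deriv_sign (f := fun u => wellPotential s u - va / 4 * (u - uPlus s) ^ 2)
    (f' := fun u => phi s u - va / 2 * (u - uPlus s))
    (a := va) (b := us) (e := uPlus s) ⟨hva', hus'⟩ ?_ ?_ hu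
  · rw [wellPotential_uPlus] at key
    simp only [sub_self, ne_eq, OfNat.ofNat_ne_zero, not_false_eq_true, zero_pow, mul_zero] at key
    linarith
  · intro x hx
    have := (hasDerivAt_wellPotential hs (lt_of_le_of_lt hx.2 hus)).sub
      ((((hasDerivAt_id x).sub_const (uPlus s)).pow 2).const_mul (va / 4))
    refine this.congr_deriv ?_
    simp only [id]; ring
  · intro x hx
    have hxs := lt_of_le_of_lt hx.2 hus
    rw [phi_eq hs hxs]
    have h2 := half_le_stiffness hs hxs
    have : (x * (x - uPlus s) * stiffness s x - va / 2 * (x - uPlus s)) * (x - uPlus s) =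
      (x - uPlus s) ^ 2 * (x * stiffness s x - va / 2) := by ring
    rw [this]
    have h5 : va * (1 / 2) ≤ x * stiffness s x :=
      mul_le_mul hx.1 h2 (by norm_num) (by linarith [hx.1])
    exact mul_nonneg (sq_nonneg _) (by linarith)

/-- The derivative of `restoring s`. -/
def restoringDeriv (s u : ℝ) : ℝ :=
  -stiffness s u + (uPlus s - u) * ((s + √(s ^ 2 + 8)) / (4 * (s - u) ^ 2))

lemma hasDerivAt_restoring {s u : ℝ} (hu : u < s) :
    HasDerivAt (restoring s) (restoringDeriv s u) u := by
  have h : s - u ≠ 0 := by linarith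
  have h1 : HasDerivAt (fun u : ℝ => 4 * (s - u)) (4 * (-1)) u := by
    simpa using ((hasDerivAt_id u).const_sub s).const_mul 4
  have h2 : HasDerivAt (stiffness s) ((s + √(s ^ 2 + 8)) / (4 * (s - u) ^ 2)) u := by
    refine ((h1.inv (by simpa using h)).const_mul (s + √(s ^ 2 + 8)) |>.const_add
      (1 / 2)).congr_deriv ?_
    field_simp
  have := ((hasDerivAt_id u).const_sub (uPlus s)).mul h2
  refine this.congr_deriv ?_
  simp only [id, restoringDeriv]; ring

lemma exists_restoring_bound {s us : ℝ} (hus : us < s) :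
    ∃ B, 0 < B ∧ ∀ u ∈ Set.Icc 0 us, |restoring s u| ≤ B ∧ |restoringDeriv s u| ≤ B := by
  have hne : ∀ u ∈ Set.Icc 0 us, s - u ≠ 0 := fun u hu => by
    have := hu.2
    linarith
  have hk : ContinuousOn (stiffness s) (Set.Icc 0 us) := by
    unfold stiffness
    refine continuousOn_const.add (continuousOn_const.div (by fun_prop) fun u hu => ?_)
    simpa using hne u hu
  have h1 : ContinuousOn (restoring s) (Set.Icc 0 us) := by
    unfold restoring
    exact (continuousOn_const.sub continuousOn_id).mul hk
  have h2 : ContinuousOn (restoringDeriv s) (Set.Icc 0 us) := by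
    unfold restoringDeriv
    refine hk.neg.add ((continuousOn_const.sub continuousOn_id).mul
      (continuousOn_const.div (by fun_prop) fun u hu => ?_))
    simpa using hne u hu
  obtain ⟨B1, hB1⟩ := isCompact_Icc.exists_bound_of_continuousOn h1
  obtain ⟨B2, hB2⟩ := isCompact_Icc.exists_bound_of_continuousOn h2
  refine ⟨max 1 (max B1 B2), by positivity, fun u hu => ⟨?_, ?_⟩⟩
  · exact (hB1 u hu).trans ((le_max_left _ _).trans (le_max_right _ _))
  · exact (hB2 u hu).trans ((le_max_right _ _).trans (le_max_right _ _))

/-! ### Heteroclinic profiles and their energy -/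

/-- The orbits `(v, w)` of `v' = w`, `w' = -c w - φ(v)` which connect the saddle `0` to the
equilibrium `u₊`. -/
structure IsProfile (s c : ℝ) (v w : ℝ → ℝ) : Prop where
  pos_c : 0 < c
  lt : ∀ τ, v τ < s
  hv : ∀ τ, HasDerivAt v (w τ) τ
  hw : ∀ τ, HasDerivAt w (-(c * w τ) - phi s (v τ)) τ
  bot : Tendsto v atBot (𝓝 0)
  top : Tendsto v atTop (𝓝 (uPlus s))

/-- The energy below the level of the saddle, at position `v` and velocity `w`. -/
def deficit (s : ℝ) (v w : ℝ → ℝ) (τ : ℝ) : ℝ :=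
  wellPotential s 0 - (w τ ^ 2 / 2 + wellPotential s (v τ))

lemma monotone_of_hasDerivAt {f f' : ℝ → ℝ} (hf : ∀ t, HasDerivAt f (f' t) t)
    (h : ∀ t, 0 ≤ f' t) : Monotone f :=
  monotone_of_deriv_nonneg (fun t => (hf t).differentiableAt) fun t => by
    rw [(hf t).deriv]; exact h t

lemma monotoneOn_of_hasDerivAt {f f' : ℝ → ℝ} {S : Set ℝ} (hS : Convex ℝ S)
    (hf : ∀ t ∈ S, HasDerivAt f (f' t) t) (h : ∀ t ∈ S, 0 ≤ f' t) : MonotoneOn f S :=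
  monotoneOn_of_deriv_nonneg hS
    (fun t ht => (hf t ht).continuousAt.continuousWithinAt)
    (fun t ht => (hf t (interior_subset ht)).differentiableAt.differentiableWithinAt)
    fun t ht => by
      rw [(hf t (interior_subset ht)).deriv]; exact h t (interior_subset ht)

/-- A nonnegative solution of `|f'| ≤ q f` which vanishes once vanishes identically. -/
lemma eq_zero_of_abs_deriv_le {f f' q : ℝ → ℝ} (hf : ∀ t, HasDerivAt f (f' t) t)
    (hq : Continuous q) (h0 : ∀ t, 0 ≤ f t) (hb : ∀ t, |f' t| ≤ q t * f t) {t₀ : ℝ}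
    (h : f t₀ = 0) (t : ℝ) : f t = 0 := by
  set Q : ℝ → ℝ := fun t => ∫ x in t₀..t, q x with hQ
  have hQd : ∀ t, HasDerivAt Q (q t) t := fun t =>
    intervalIntegral.integral_hasDerivAt_right (hq.intervalIntegrable _ _)
      hq.aestronglyMeasurable.stronglyMeasurableAtFilter hq.continuousAt
  have hup : Monotone fun t => f t * Real.exp (Q t) := by
    refine monotone_of_hasDerivAt (fun t => (hf t).mul (hQd t).exp) fun t => ?_
    have := (abs_le.1 (hb t)).1
    have : f' t * Real.exp (Q t) + f t * (Real.exp (Q t) * q t) =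
      (f' t + q t * f t) * Real.exp (Q t) := by ring
    rw [this]
    exact mul_nonneg (by linarith) (Real.exp_pos _).le
  have hdown : Monotone fun t => -(f t * Real.exp (-Q t)) := by
    refine monotone_of_hasDerivAt (f' := fun t => -(f' t * Real.exp (-Q t) +
      f t * (Real.exp (-Q t) * -q t))) (fun t => ((hf t).mul (hQd t).neg.exp).neg) fun t => ?_
    have := (abs_le.1 (hb t)).2
    have : -(f' t * Real.exp (-Q t) + f t * (Real.exp (-Q t) * -q t)) =
      (q t * f t - f' t) * Real.exp (-Q t) := by ring
    rw [this]
    exact mul_nonneg (by linarith) (Real.exp_pos _).le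
  refine le_antisymm ?_ (h0 t)
  rcases le_total t t₀ with ht | ht
  · have := hup ht
    simp only [h, zero_mul] at this
    exact nonpos_of_mul_nonpos_left this (Real.exp_pos _)
  · have := hdown ht
    simp only [h, zero_mul, neg_zero] at this
    exact nonpos_of_mul_nonpos_left (by linarith) (Real.exp_pos (-Q t))

/-- Along a bounded motion whose energy decreases and whose potential energy converges, the velocity
tends to zero: by the mean value theorem it is small at some time of each unit interval, and
afterwards the energy keeps it small. -/
lemma tendsto_velocity_zero {v w P : ℝ → ℝ} {a p : ℝ} {l : Filter ℝ}
    (hv : ∀ t, HasDerivAt v (w t) t) (hE : Antitone fun t => w t ^ 2 / 2 + P t)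
    (hlim : ∀ θ > 0, ∀ᶠ t in l, ∀ x ∈ Set.Icc (t - 1) t, |v x - a| < θ ∧ |P x - p| < θ) :
    Tendsto w l (𝓝 0) := by
  rw [Metric.tendsto_nhds]
  intro r hr
  set θ := min 1 (r ^ 2 / 16) with hθ
  have hθ0 : 0 < θ := by positivity
  filter_upwards [hlim θ hθ0] with t ht
  obtain ⟨x, hx, hxw⟩ := exists_hasDerivAt_eq_slope v w (show t - 1 < t by linarith)
    (fun x _ => (hv x).continuousAt.continuousWithinAt) (fun x _ => hv x)
  have h1 := abs_lt.1 (ht (t - 1) ⟨le_rfl, by linarith⟩).1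
  have h2 := abs_lt.1 (ht t ⟨by linarith, le_rfl⟩).1
  have h3 := abs_lt.1 (ht t ⟨by linarith, le_rfl⟩).2
  have h4 := abs_lt.1 (ht x ⟨hx.1.le, hx.2.le⟩).2
  have h5 : w x = v t - v (t - 1) := by rw [hxw]; field_simp; ring
  have h6 : w x ^ 2 ≤ (2 * θ) ^ 2 := sq_le_sq' (by linarith) (by linarith)
  have h7 := hE hx.2.le
  simp only at h7
  have h8 : θ ≤ 1 := min_le_left _ _
  have h9 : θ ≤ r ^ 2 / 16 := min_le_right _ _
  rw [Real.dist_eq, sub_zero]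
  refine abs_lt_of_sq_lt_sq ?_ hr.le
  nlinarith

namespace IsProfile

variable {s c : ℝ} {v w : ℝ → ℝ}

lemma continuous_v (h : IsProfile s c v w) : Continuous v :=
  continuous_iff_continuousAt.2 fun t => (h.hv t).continuousAt

lemma continuous_w (h : IsProfile s c v w) : Continuous w :=
  continuous_iff_continuousAt.2 fun t => (h.hw t).continuousAt

lemma hasDerivAt_potential (h : IsProfile s c v w) (hs : 1 < s) (t : ℝ) :
    HasDerivAt (fun t => wellPotential s (v t)) (phi s (v t) * w t) t :=
  (hasDerivAt_wellPotential hs (h.lt t)).comp t (h.hv t)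

lemma hasDerivAt_deficit (h : IsProfile s c v w) (hs : 1 < s) (t : ℝ) :
    HasDerivAt (deficit s v w) (c * w t ^ 2) t := by
  have := ((((h.hw t).pow 2).div_const 2).add (h.hasDerivAt_potential hs t)).const_sub
    (wellPotential s 0)
  refine this.congr_deriv ?_
  norm_num
  ring

lemma monotone_deficit (h : IsProfile s c v w) (hs : 1 < s) : Monotone (deficit s v w) :=
  monotone_of_hasDerivAt (h.hasDerivAt_deficit hs) fun _ =>
    mul_nonneg h.pos_c.le (sq_nonneg _)

lemma antitone_energy (h : IsProfile s c v w) (hs : 1 < s) :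
    Antitone fun t => w t ^ 2 / 2 + wellPotential s (v t) := fun a b hab => by
  have := h.monotone_deficit hs hab
  unfold deficit at this
  simp only
  linarith

lemma tendsto_potential {l : Filter ℝ} {a : ℝ} (hs : 1 < s) (ha : a < s)
    (hl : Tendsto v l (𝓝 a)) :
    Tendsto (fun t => wellPotential s (v t)) l (𝓝 (wellPotential s a)) :=
  (hasDerivAt_wellPotential hs ha).continuousAt.tendsto.comp hl

lemma w_bot (h : IsProfile s c v w) (hs : 1 < s) : Tendsto w atBot (𝓝 0) := by
  refine tendsto_velocity_zero (a := 0) (p := wellPotential s 0) h.hv (h.antitone_energy hs)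
    fun θ hθ => ?_
  have h1 := Metric.tendsto_nhds.1 h.bot θ hθ
  have h2 := Metric.tendsto_nhds.1 (tendsto_potential hs (by linarith) h.bot) θ hθ
  obtain ⟨T, hT⟩ := eventually_atBot.1 (h1.and h2)
  filter_upwards [eventually_le_atBot T] with t ht x hx
  exact hT x (hx.2.trans ht)

lemma w_top (h : IsProfile s c v w) (hs : 1 < s) : Tendsto w atTop (𝓝 0) := by
  refine tendsto_velocity_zero (a := uPlus s) (p := wellPotential s (uPlus s)) h.hv
    (h.antitone_energy hs) fun θ hθ => ?_
  have h1 := Metric.tendsto_nhds.1 h.top θ hθ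
  have h2 := Metric.tendsto_nhds.1 (tendsto_potential hs (uPlus_lt hs) h.top) θ hθ
  obtain ⟨T, hT⟩ := eventually_atTop.1 (h1.and h2)
  filter_upwards [eventually_ge_atTop (T + 1)] with t ht x hx
  exact hT x (by linarith [hx.1])

lemma deficit_bot (h : IsProfile s c v w) (hs : 1 < s) :
    Tendsto (deficit s v w) atBot (𝓝 0) := by
  have := ((((h.w_bot hs).pow 2).div_const 2).add
    (tendsto_potential hs (by linarith) h.bot)).const_sub (wellPotential s 0)
  rwa [show wellPotential s 0 - (0 ^ 2 / 2 + wellPotential s 0) = 0 by ring] at this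

lemma deficit_top (h : IsProfile s c v w) (hs : 1 < s) :
    Tendsto (deficit s v w) atTop (𝓝 (wellPotential s 0)) := by
  have := ((((h.w_top hs).pow 2).div_const 2).add
    (tendsto_potential hs (uPlus_lt hs) h.top)).const_sub (wellPotential s 0)
  rw [wellPotential_uPlus] at this
  rwa [show wellPotential s 0 - (0 ^ 2 / 2 + 0) = wellPotential s 0 by ring] at this

/-- The orbit does not meet the equilibria. -/
lemma not_equilibrium (h : IsProfile s c v w) (hs : 1 < s) {t : ℝ} (hw : w t = 0) :
    phi s (v t) ≠ 0 := by
  intro hphi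
  have hk : Continuous fun t => stiffness s (v t) := by
    unfold stiffness
    refine continuous_const.add (continuous_const.div
      (continuous_const.mul (continuous_const.sub h.continuous_v)) fun t => ?_)
    have := h.lt t
    have : s - v t ≠ 0 := by linarith
    simpa using this
  have hup := uPlus_pos hs
  -- `φ(v) = (v - e) r` for either equilibrium `e`, with a continuous function `r` of time
  have key : ∀ (e : ℝ) (r : ℝ → ℝ), Continuous r → (∀ t, phi s (v t) = (v t - e) * r t) →
      v t = e → ∀ t, v t = e := by
    intro e r hr hphi hvt x
    have hd : ∀ t, HasDerivAt (fun t => (v t - e) ^ 2 + w t ^ 2)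
        (2 * (v t - e) * w t + 2 * w t * (-(c * w t) - (v t - e) * r t)) t := fun t => by
      refine (((h.hv t).sub_const e).pow 2 |>.add ((h.hw t).pow 2)).congr_deriv ?_
      rw [hphi t]; norm_num
    have hzero := eq_zero_of_abs_deriv_le hd (q := fun t => 1 + 2 * c + |r t|)
      (by fun_prop) (fun t => by positivity) (fun t => ?_) (t₀ := t) (by simp [hvt, hw]) x
    · have : (v x - e) ^ 2 = 0 := by nlinarith [sq_nonneg (v x - e), sq_nonneg (w x)]
      have := pow_eq_zero_iff (two_ne_zero) |>.1 this
      linarith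
    · have hc := h.pos_c
      set y := v t - e
      have h1 : 2 * |y * w t| ≤ y ^ 2 + w t ^ 2 := by
        rw [abs_mul]
        nlinarith [sq_nonneg (|y| - |w t|), sq_abs y, sq_abs (w t)]
      have h2 : 2 * y * w t + 2 * w t * (-(c * w t) - y * r t) =
          2 * (y * w t) * (1 - r t) - 2 * c * w t ^ 2 := by ring
      rw [h2]
      have h3 : |1 - r t| ≤ 1 + |r t| := by
        simpa using abs_sub (1 : ℝ) (r t)
      calc |2 * (y * w t) * (1 - r t) - 2 * c * w t ^ 2|
          ≤ |2 * (y * w t) * (1 - r t)| + |2 * c * w t ^ 2| := abs_sub _ _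
        _ = 2 * |y * w t| * |1 - r t| + 2 * c * w t ^ 2 := by
            rw [abs_mul, abs_mul, abs_of_pos (two_pos : (0 : ℝ) < 2),
              abs_of_nonneg (by positivity : 0 ≤ 2 * c * w t ^ 2)]
        _ ≤ (y ^ 2 + w t ^ 2) * (1 + |r t|) + 2 * c * (y ^ 2 + w t ^ 2) := by
            gcongr
            nlinarith [sq_nonneg y]
        _ = (1 + 2 * c + |r t|) * (y ^ 2 + w t ^ 2) := by ring
  have hc1 : Tendsto v atTop (𝓝 (v t)) → Tendsto v atBot (𝓝 (v t)) → False := fun h1 h2 => by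
    have e1 := tendsto_nhds_unique h.top h1
    have e2 := tendsto_nhds_unique h.bot h2
    linarith
  have hconst : ∀ x, v x = v t := by
    rcases (phi_eq_zero_iff hs (h.lt t)).1 hphi with h0 | h0
    · rw [h0]
      refine key 0 (fun t => (v t - uPlus s) * stiffness s (v t))
        ((h.continuous_v.sub continuous_const).mul hk) (fun t => ?_) h0
      rw [phi_eq hs (h.lt t)]; ring
    · rw [h0]
      refine key (uPlus s) (fun t => v t * stiffness s (v t)) (h.continuous_v.mul hk)
        (fun t => ?_) h0
      rw [phi_eq hs (h.lt t)]; ring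
  have hv : v = fun _ => v t := funext hconst
  refine hc1 ?_ ?_
  · rw [hv]; exact tendsto_const_nhds
  · rw [hv]; exact tendsto_const_nhds

lemma strictMono_deficit (h : IsProfile s c v w) (hs : 1 < s) :
    StrictMono (deficit s v w) := by
  have hm := h.monotone_deficit hs
  refine hm.strictMono_of_injective fun a b hab => ?_
  by_contra hne
  wlog hlt : a < b generalizing a b
  · exact this b a hab.symm (Ne.symm hne) (lt_of_le_of_ne (not_lt.1 hlt) (Ne.symm hne))
  -- on an interval of constant energy the velocity vanishes, hence so does the force
  have hw0 : ∀ x ∈ Set.Ioo a b, w x = 0 := by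
    intro x hx
    have hev : deficit s v w =ᶠ[𝓝 x] fun _ => deficit s v w a := by
      filter_upwards [Ioo_mem_nhds hx.1 hx.2] with y hy
      exact le_antisymm ((hm hy.2.le).trans_eq hab.symm) (hm hy.1.le)
    have h1 := (h.hasDerivAt_deficit hs x).unique
      ((hasDerivAt_const x (deficit s v w a)).congr_of_eventuallyEq hev)
    have h2 : w x ^ 2 = 0 := (mul_eq_zero.1 h1).resolve_left h.pos_c.ne'
    exact pow_eq_zero_iff (two_ne_zero) |>.1 h2
  obtain ⟨x, hx⟩ := Set.nonempty_Ioo.2 hlt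
  have hev : w =ᶠ[𝓝 x] fun _ => 0 := by
    filter_upwards [Ioo_mem_nhds hx.1 hx.2] with y hy using hw0 y hy
  have h1 := (h.hw x).unique ((hasDerivAt_const x (0 : ℝ)).congr_of_eventuallyEq hev)
  refine h.not_equilibrium hs (hw0 x hx) ?_
  rw [hw0 x hx] at h1
  linarith

lemma deficit_pos (h : IsProfile s c v w) (hs : 1 < s) (t : ℝ) : 0 < deficit s v w t := by
  have h1 : deficit s v w (t - 1) < deficit s v w t := h.strictMono_deficit hs (by linarith)
  have h2 : 0 ≤ deficit s v w (t - 1) :=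
    (h.monotone_deficit hs).le_of_tendsto (h.deficit_bot hs) _
  linarith

lemma deficit_lt (h : IsProfile s c v w) (hs : 1 < s) (t : ℝ) :
    deficit s v w t < wellPotential s 0 := by
  have h1 : deficit s v w t < deficit s v w (t + 1) := h.strictMono_deficit hs (by linarith)
  have h2 : deficit s v w (t + 1) ≤ wellPotential s 0 :=
    (h.monotone_deficit hs).ge_of_tendsto (h.deficit_top hs) _
  linarith

lemma potential_lt (h : IsProfile s c v w) (hs : 1 < s) (t : ℝ) :
    wellPotential s (v t) < wellPotential s 0 := by
  have := h.deficit_pos hs t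
  unfold deficit at this
  nlinarith [sq_nonneg (w t)]

lemma pos (h : IsProfile s c v w) (hs : 1 < s) (t : ℝ) : 0 < v t := by
  by_contra hc
  have hev : ∀ᶠ x in atTop, uPlus s / 2 < v x :=
    h.top.eventually_const_lt (by linarith [uPlus_pos hs])
  obtain ⟨x, hx, hxt⟩ := (hev.and (eventually_ge_atTop t)).exists
  obtain ⟨y, -, hy⟩ := intermediate_value_Icc hxt h.continuous_v.continuousOn
    (show (0 : ℝ) ∈ Set.Icc (v t) (v x) from ⟨not_lt.1 hc, by linarith [uPlus_pos hs]⟩)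
  have := h.potential_lt hs y
  rw [hy] at this
  exact lt_irrefl _ this

lemma lt_end {us : ℝ} (h : IsProfile s c v w) (hs : 1 < s)
    (hW : IsWell (phi s) 0 (uPlus s) us) (t : ℝ) : v t < us := by
  by_contra hc
  have hev : ∀ᶠ x in atTop, v x < us := h.top.eventually_lt_const hW.lt_end
  obtain ⟨x, hx, hxt⟩ := (hev.and (eventually_ge_atTop t)).exists
  obtain ⟨y, -, hy⟩ := intermediate_value_Icc' hxt h.continuous_v.continuousOn
    (show us ∈ Set.Icc (v x) (v t) from ⟨hx.le, not_lt.1 hc⟩)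
  have := h.potential_lt hs y
  rw [hy] at this
  exact absurd hW.potential_end this.ne

lemma mem_Icc {us : ℝ} (h : IsProfile s c v w) (hs : 1 < s)
    (hW : IsWell (phi s) 0 (uPlus s) us) (t : ℝ) : v t ∈ Set.Icc 0 us :=
  ⟨(h.pos hs t).le, (h.lt_end hs hW t).le⟩

/-- The orbit passes every level below `u₊` for a first time. -/
lemma exists_first (h : IsProfile s c v w) {m : ℝ} (hm : 0 < m)
    (hex : ∃ t, m ≤ v t) : ∃ t, v t = m ∧ ∀ x < t, v x < m := by
  have hbot := eventually_atBot.1 (h.bot.eventually_lt_const hm)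
  obtain ⟨T, hT⟩ := hbot
  set S := {t | m ≤ v t} with hS
  have hclosed : IsClosed S := isClosed_le continuous_const h.continuous_v
  have hbdd : BddBelow S := ⟨T, fun x hx => by
    by_contra hc
    exact absurd (hT x (not_le.1 hc).le) (not_lt.2 hx)⟩
  have hmem : sInf S ∈ S := hclosed.csInf_mem hex hbdd
  have hlt : ∀ x < sInf S, v x < m := fun x hx => by
    by_contra hc
    exact absurd (csInf_le hbdd (show x ∈ S from not_lt.1 hc)) (not_le.2 hx)
  refine ⟨sInf S, le_antisymm ?_ hmem, hlt⟩
  refine le_of_tendsto (h.continuous_v.continuousWithinAt (s := Set.Iio (sInf S))) ?_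
  filter_upwards [self_mem_nhdsWithin] with x hx using (hlt x hx).le

lemma exists_first_of_lt (h : IsProfile s c v w) {m : ℝ} (hm : 0 < m) (hm' : m < uPlus s) :
    ∃ t, v t = m ∧ ∀ x < t, v x < m :=
  h.exists_first hm ((h.top.eventually_const_lt hm').exists.imp fun _ h => h.le)

end IsProfile

/-! ### The front of the wave -/

/-- The rate, in the variable `τ`, at which a profile grows while it is below the level `m`. -/
def frontRate (s m c : ℝ) : ℝ := min 1 ((uPlus s - m) / 2) / (1 + c)

lemma frontRate_pos {s m c : ℝ} (hm : m < uPlus s) (hc : 0 < c) : 0 < frontRate s m c := by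
  unfold frontRate
  have : 0 < (uPlus s - m) / 2 := by linarith
  positivity

lemma nonneg_of_monotoneOn_Iic {f : ℝ → ℝ} {t₀ t : ℝ} (hf : MonotoneOn f (Set.Iic t₀))
    (hl : Tendsto f atBot (𝓝 0)) (ht : t ≤ t₀) : 0 ≤ f t :=
  le_of_tendsto hl <| by
    filter_upwards [eventually_le_atBot t] with x hx using hf (hx.trans ht) ht hx

lemma le_of_first {v : ℝ → ℝ} {m t₀ : ℝ} (hv : v t₀ = m) (hlt : ∀ x < t₀, v x < m) :
    ∀ x ≤ t₀, v x ≤ m := fun x hx => by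
  rcases hx.lt_or_eq with hx | rfl
  · exact (hlt x hx).le
  · exact hv.le

namespace IsProfile

variable {s c : ℝ} {v w : ℝ → ℝ}

/-- Below the level `m < u₊` the velocity `w` dominates a multiple of `v`: for `β = frontRate s m c`
the function `(w - β v) e^{(c + β) τ}` increases from the value `0` at `-∞`. -/
lemma front_velocity (h : IsProfile s c v w) (hs : 1 < s) {m t₀ : ℝ} (hm : m < uPlus s)
    (hlt : ∀ x ≤ t₀, v x ≤ m) {t : ℝ} (ht : t ≤ t₀) : frontRate s m c * v t ≤ w t := by
  set β := frontRate s m c with hβ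
  have hc := h.pos_c
  have hβ0 : 0 < β := frontRate_pos hm hc
  -- The right-hand side is a lower bound of `-φ(v) / v` below the level `m`.
  have hβc : β * (c + β) ≤ (uPlus s - m) / 2 := by
    have hb1 : min 1 ((uPlus s - m) / 2) ≤ 1 := min_le_left _ _
    have hb2 : min 1 ((uPlus s - m) / 2) ≤ (uPlus s - m) / 2 := min_le_right _ _
    have e : β * (1 + c) = min 1 ((uPlus s - m) / 2) := by
      rw [hβ, frontRate]; field_simp
    have : β ≤ 1 := by nlinarith
    nlinarith
  have hmono : MonotoneOn (fun t => (w t - β * v t) * Real.exp ((c + β) * t)) (Set.Iic t₀) := by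
    refine monotoneOn_of_hasDerivAt (convex_Iic t₀) (fun t _ => ((h.hw t).sub
      ((h.hv t).const_mul β)).mul (((hasDerivAt_id t).const_mul (c + β)).exp)) fun t ht => ?_
    have hg : (uPlus s - m) / 2 ≤ restoring s (v t) := by
      have h1 := half_le_stiffness hs (h.lt t)
      have h2 := hlt t ht
      have h3 : (uPlus s - m) * (1 / 2) ≤ (uPlus s - v t) * stiffness s (v t) :=
        mul_le_mul (by linarith) h1 (by norm_num) (by linarith)
      unfold restoring
      linarith
    rw [phi_eq_restoring hs (h.lt t)]
    have e : (-(c * w t) - -(v t * restoring s (v t)) - β * w t) * Real.exp ((c + β) * id t) +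
        (w t - β * v t) * (Real.exp ((c + β) * id t) * ((c + β) * 1)) =
        v t * (restoring s (v t) - β * (c + β)) * Real.exp ((c + β) * t) := by
      simp only [id]; ring
    exact e.symm ▸ mul_nonneg (mul_nonneg (h.pos hs t).le (by linarith)) (Real.exp_pos _).le
  have hlim : Tendsto (fun t => (w t - β * v t) * Real.exp ((c + β) * t)) atBot (𝓝 0) := by
    have h1 : Tendsto (fun t => Real.exp ((c + β) * t)) atBot (𝓝 0) :=
      Real.tendsto_exp_atBot.comp (tendsto_id.const_mul_atBot (by positivity))
    simpa using ((h.w_bot hs).sub (h.bot.const_mul β)).mul h1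
  have := nonneg_of_monotoneOn_Iic hmono hlim ht
  have := nonneg_of_mul_nonneg_left this (Real.exp_pos _)
  linarith

lemma front_deficit (h : IsProfile s c v w) (hs : 1 < s) {m t₀ : ℝ} (hm : m < uPlus s)
    (hlt : ∀ x ≤ t₀, v x ≤ m) :
    c * frontRate s m c / 2 * v t₀ ^ 2 ≤ deficit s v w t₀ := by
  set β := frontRate s m c with hβ
  have hc := h.pos_c
  have hβ0 : 0 < β := frontRate_pos hm hc
  have hmono : MonotoneOn (fun t => deficit s v w t - c * β / 2 * v t ^ 2) (Set.Iic t₀) := by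
    refine monotoneOn_of_hasDerivAt (convex_Iic t₀) (fun t _ => (h.hasDerivAt_deficit hs t).sub
      (((h.hv t).pow 2).const_mul _)) fun t ht => ?_
    have h1 := h.front_velocity hs hm hlt ht
    have h2 := h.pos hs t
    have h3 : 0 ≤ w t := le_trans (by positivity) h1
    norm_num
    have e : c * w t ^ 2 - c * β / 2 * (2 * v t * w t) = c * (w t * (w t - β * v t)) := by ring
    have h4 : 0 ≤ c * (w t * (w t - β * v t)) :=
      mul_nonneg hc.le (mul_nonneg h3 (by linarith))
    linarith
  have hlim := (h.deficit_bot hs).sub ((h.bot.pow 2).const_mul (c * β / 2))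
  have := nonneg_of_monotoneOn_Iic hmono (by simpa using hlim) (le_refl t₀)
  linarith

lemma front_decay (h : IsProfile s c v w) (hs : 1 < s) {m t₀ : ℝ} (hm : m < uPlus s)
    (hlt : ∀ x ≤ t₀, v x ≤ m) {t : ℝ} (ht : t ≤ t₀) :
    v t ≤ v t₀ * Real.exp (-(frontRate s m c * (t₀ - t))) := by
  set β := frontRate s m c with hβ
  have hmono : MonotoneOn (fun t => v t * Real.exp (-(β * t))) (Set.Iic t₀) := by
    refine monotoneOn_of_hasDerivAt (convex_Iic t₀) (fun t _ => (h.hv t).mul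
      (((hasDerivAt_id t).const_mul β).neg.exp)) fun t ht => ?_
    have h1 := h.front_velocity hs hm hlt ht
    have e : w t * Real.exp (-(β * t)) + v t * (Real.exp (-(β * t)) * -(β * 1)) =
      (w t - β * v t) * Real.exp (-(β * t)) := by ring
    simp only [id, Pi.neg_apply]
    rw [e]
    exact mul_nonneg (by linarith) (Real.exp_pos _).le
  have := hmono ht (Set.mem_Iic.2 le_rfl) ht
  simp only at this
  have e : -(β * (t₀ - t)) = -(β * t₀) + β * t := by ring
  rw [e, Real.exp_add, ← mul_assoc]
  calc v t = v t * Real.exp (-(β * t)) * Real.exp (β * t) := by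
        rw [mul_assoc, ← Real.exp_add]; simp
    _ ≤ _ := by gcongr

/-- When the profile first passes the level `m < u₊`, an energy of order `c / (1 + c)` has been
dissipated. -/
lemma deficit_of_first (h : IsProfile s c v w) (hs : 1 < s) {m t₀ : ℝ} (hm : m < uPlus s)
    (hv : v t₀ = m) (hlt : ∀ x < t₀, v x < m) :
    min 1 ((uPlus s - m) / 2) / 2 * m ^ 2 * c / (1 + c) ≤ deficit s v w t₀ := by
  have hc := h.pos_c
  have h1 := h.front_deficit hs hm (le_of_first hv hlt)
  refine le_trans (le_of_eq ?_) h1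
  rw [hv, frontRate]
  field_simp

/-- No critical point precedes the first passage of the level `u₊ / 2`, so there is the same lower
bound for the dissipated energy at critical points. -/
lemma deficit_of_critical (h : IsProfile s c v w) (hs : 1 < s) {t : ℝ} (hw : w t = 0) :
    min 1 ((uPlus s - uPlus s / 2) / 2) / 2 * (uPlus s / 2) ^ 2 * c / (1 + c) ≤
      deficit s v w t := by
  have hup := uPlus_pos hs
  have hm : uPlus s / 2 < uPlus s := by linarith
  obtain ⟨t₀, ht₀, hlt⟩ := h.exists_first_of_lt (half_pos hup) hm
  refine (h.deficit_of_first hs hm ht₀ hlt).trans (h.monotone_deficit hs ?_)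
  by_contra hcon
  have := h.front_velocity hs hm (le_of_first ht₀ hlt) (not_le.1 hcon).le
  rw [hw] at this
  have := mul_pos (frontRate_pos hm h.pos_c) (h.pos hs t)
  linarith

end IsProfile

/-! ### The duration of the oscillations -/

/-- The lower bound for the derivative of the function `L` in `exists_duration_bound`. -/
lemma lyapunov_bound {c v w g g' x κ M B W X e : ℝ} (hc : 0 < c) (hx : 0 < x) (hxX : x ≤ X)
    (hκ : 0 < κ) (hM : 0 < M) (hg : |g| ≤ B) (hg' : |g'| ≤ B) (hw : |w| ≤ W) (hv : κ * x ≤ v)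
    (he : e ≤ w ^ 2 / 2 + 2 * M * g ^ 2) :
    κ * e / (4 * M) ≤ v * g ^ 2 / x - c * w * g / x + g' * w ^ 2 / x - c * w ^ 3 * g / (2 * x ^ 3)
      + 2 * (B + κ * X / (8 * M)) * w ^ 2 / (2 * x) + c ^ 2 * w ^ 2 / (2 * κ * x ^ 2)
      + B * W * c * w ^ 2 / (2 * x ^ 3) := by
  have h1 : κ * g ^ 2 ≤ v * g ^ 2 / x := by
    rw [le_div_iff₀ hx]
    nlinarith [mul_le_mul_of_nonneg_right hv (sq_nonneg g)]
  have h2 : 0 ≤ κ / 2 * g ^ 2 + c ^ 2 * w ^ 2 / (2 * κ * x ^ 2) - c * w * g / x := by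
    have : κ / 2 * g ^ 2 + c ^ 2 * w ^ 2 / (2 * κ * x ^ 2) - c * w * g / x =
        κ / 2 * (g - c * w / (κ * x)) ^ 2 := by
      field_simp
      ring
    rw [this]
    positivity
  have h3 : 0 ≤ (B + g') * w ^ 2 / x :=
    div_nonneg (mul_nonneg (by linarith [(abs_le.1 hg').1]) (sq_nonneg w)) hx.le
  have h4 : 0 ≤ (B * W - w * g) * (c * w ^ 2) / (2 * x ^ 3) := by
    have : w * g ≤ W * B := (le_abs_self _).trans (by
      rw [abs_mul]; exact mul_le_mul hw hg (abs_nonneg _) ((abs_nonneg _).trans hw))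
    exact div_nonneg (mul_nonneg (by linarith) (by positivity)) (by positivity)
  have h5 : κ / (8 * M) * w ^ 2 ≤ κ * X / (8 * M) * w ^ 2 / x := by
    rw [le_div_iff₀ hx]
    have : κ / (8 * M) * w ^ 2 * x ≤ κ / (8 * M) * w ^ 2 * X := by gcongr
    calc _ ≤ _ := this
      _ = _ := by ring
  have h6 : κ * e / (4 * M) ≤ κ / 2 * g ^ 2 + κ / (8 * M) * w ^ 2 := by
    have : κ / 2 * g ^ 2 + κ / (8 * M) * w ^ 2 =
        κ * (w ^ 2 / 2 + 2 * M * g ^ 2) / (4 * M) := by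
      field_simp
      ring
    rw [this]
    gcongr
  have e1 : (B + g') * w ^ 2 / x = B * w ^ 2 / x + g' * w ^ 2 / x := by ring
  have e2 : (B * W - w * g) * (c * w ^ 2) / (2 * x ^ 3) =
      B * W * c * w ^ 2 / (2 * x ^ 3) - c * w ^ 3 * g / (2 * x ^ 3) := by ring
  have e3 : 2 * (B + κ * X / (8 * M)) * w ^ 2 / (2 * x) =
      B * w ^ 2 / x + κ * X / (8 * M) * w ^ 2 / x := by
    field_simp
  rw [e1] at h3
  rw [e2] at h4
  rw [e3]
  linarith

/-- The derivative of the function `L` in `exists_duration_bound`. -/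
lemma IsProfile.hasDerivAt_lyapunov {s c : ℝ} {v w : ℝ → ℝ} (h : IsProfile s c v w) (hs : 1 < s)
    (a κ d t : ℝ) :
    HasDerivAt (fun t => w t * restoring s (v t) / √(deficit s v w t) +
        a / c * √(deficit s v w t) + c / κ * Real.log √(deficit s v w t) -
        d * (√(deficit s v w t))⁻¹)
      (v t * restoring s (v t) ^ 2 / √(deficit s v w t) -
        c * w t * restoring s (v t) / √(deficit s v w t) +
        restoringDeriv s (v t) * w t ^ 2 / √(deficit s v w t) -
        c * w t ^ 3 * restoring s (v t) / (2 * √(deficit s v w t) ^ 3) +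
        a * w t ^ 2 / (2 * √(deficit s v w t)) +
        c ^ 2 * w t ^ 2 / (2 * κ * √(deficit s v w t) ^ 2) +
        d * c * w t ^ 2 / (2 * √(deficit s v w t) ^ 3)) t := by
  have hc := h.pos_c.ne'
  have hx : √(deficit s v w t) ≠ 0 := (Real.sqrt_pos.2 (h.deficit_pos hs t)).ne'
  have hxd := (h.hasDerivAt_deficit hs t).sqrt (h.deficit_pos hs t).ne'
  have hgd := (hasDerivAt_restoring (h.lt t)).comp t (h.hv t)
  refine ((((h.hw t).mul hgd).div hxd hx).add (hxd.const_mul (a / c)) |>.add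
    ((hxd.log hx).const_mul (c / κ)) |>.sub ((hxd.inv hx).const_mul d)).congr_deriv ?_
  rw [phi_eq_restoring hs (h.lt t)]
  simp only [Pi.mul_apply, Function.comp_apply]
  generalize √(deficit s v w t) = x at *
  rcases eq_or_ne κ 0 with rfl | hκ
  · simp
    field_simp
    ring
  · field_simp
    ring

lemma duration_bound_arith {c k x G κ a X : ℝ} (hc : 0 < c) (hk : 0 < k) (hx : 0 < x)
    (hD : k * c / (1 + c) ≤ x ^ 2) (hG : 0 < G) (hκ : 0 < κ) (ha : 0 < a) (hX : 0 < X) :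
    3 * G / x + a / c * X + c / κ * (X / x) ≤
      (2 * (3 * G + X / κ) / √k + a * X) * (c + 1 / c) := by
  have hk0 := Real.sqrt_pos.2 hk
  have hxlow : 1 / x ≤ (1 + c) / (c * √k) := by
    rw [div_le_div_iff₀ hx (by positivity), one_mul]
    have h1 : √k * (c / (1 + c)) ≤ x := by
      refine (abs_le_of_sq_le_sq' ?_ hx.le).2
      rw [mul_pow, Real.sq_sqrt hk.le]
      refine le_trans ?_ hD
      rw [mul_div_assoc]
      have h2 : c / (1 + c) ≤ 1 := by rw [div_le_one (by linarith)]; linarith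
      have h3 : 0 ≤ c / (1 + c) := by positivity
      nlinarith [mul_le_mul_of_nonneg_left h2 (mul_nonneg hk.le h3)]
    have h2 : √k * (c / (1 + c)) * (1 + c) ≤ x * (1 + c) := by gcongr
    have h3 : √k * (c / (1 + c)) * (1 + c) = c * √k := by field_simp
    linarith
  set A := 3 * G + X / κ with hA
  have hA0 : 0 < A := by positivity
  have h1 : 3 * G / x + c / κ * (X / x) ≤ A * (1 + c) * (1 / x) := by
    have : A * (1 + c) * (1 / x) - (3 * G / x + c / κ * (X / x)) =
      (3 * G * c + X / κ) * (1 / x) := by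
      rw [hA]; ring
    have : 0 ≤ (3 * G * c + X / κ) * (1 / x) := by positivity
    linarith
  have h2 : A * (1 + c) * (1 / x) ≤ A * (1 + c) * ((1 + c) / (c * √k)) := by gcongr
  have h3 : A * (1 + c) * ((1 + c) / (c * √k)) = A / √k * ((1 + c) ^ 2 / c) := by
    field_simp
  have h4 : (1 + c) ^ 2 / c ≤ 2 * (c + 1 / c) := by
    have : 2 * (c + 1 / c) - (1 + c) ^ 2 / c = (c - 1) ^ 2 / c := by
      field_simp
      ring
    have : 0 ≤ (c - 1) ^ 2 / c := by positivity
    linarith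
  have h5 : A / √k * ((1 + c) ^ 2 / c) ≤ A / √k * (2 * (c + 1 / c)) := by gcongr
  have h6 : a / c * X ≤ a * X * (c + 1 / c) := by
    have : a * X * (c + 1 / c) = a / c * X + a * X * c := by ring
    have : 0 ≤ a * X * c := by positivity
    linarith
  have h7 : (2 * A / √k + a * X) * (c + 1 / c) =
    A / √k * (2 * (c + 1 / c)) + a * X * (c + 1 / c) := by ring
  rw [h7]
  linarith

/-- If the energy dissipated up to the time `t₀` is at least of order `c / (1 + c)`, then the energy
falls below any given level within a time of order `c + 1 / c`, for all `c > 0` alike.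

The passages near the saddle are slow when the deficit `D` is small. They are controlled by the
Lyapunov function `L = w g(v) / x + (a / c) x + (c / κ) log x - d / x`, where `x = √D` and
`g(v) = -φ(v) / v`. Indeed `(w g / x)'` contains `v g ^ 2 / x`, which is bounded below near the
saddle since `x` is at most of order `v`; the other terms of `(w g / x)'` are compensated by the
functions of `x`, whose derivatives are multiples of `D' = c w ^ 2`. -/
lemma exists_duration_bound {s : ℝ} (hs : 1 < s) {e k : ℝ} (he : 0 < e) (hk : 0 < k) :
    ∃ C, 0 < C ∧ ∀ {c : ℝ} {v w : ℝ → ℝ}, IsProfile s c v w → ∀ {t₀ t₁ : ℝ}, t₀ ≤ t₁ →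
      k * c / (1 + c) ≤ deficit s v w t₀ → e ≤ w t₁ ^ 2 / 2 + wellPotential s (v t₁) →
      t₁ - t₀ ≤ C * (c + 1 / c) := by
  obtain ⟨us, hus, hW⟩ := exists_isWell hs
  obtain ⟨B, hB, hbound⟩ := exists_restoring_bound hus
  have hup := uPlus_pos hs
  have hus0 : 0 < us := hup.trans hW.lt_end
  have hst := half_le_stiffness hs hus
  set P := uPlus s * stiffness s us with hP
  have hP0 : 0 < P := mul_pos hup (by linarith)
  set M := us * stiffness s us with hM
  have hM0 : 0 < M := mul_pos hus0 (by linarith)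
  have hE0 := wellPotential_zero_pos hs
  set X := √(wellPotential s 0) with hX
  have hX0 : 0 < X := Real.sqrt_pos.2 hE0
  set W := √(2 * wellPotential s 0) with hWdef
  have hW0 : 0 < W := Real.sqrt_pos.2 (by linarith)
  set κ := √(2 / P) with hκ
  have hκ0 : 0 < κ := Real.sqrt_pos.2 (by positivity)
  set a := 2 * (B + κ * X / (8 * M)) with ha
  have ha0 : 0 < a := by positivity
  set A := 3 * (B * W) + X / κ with hA
  have hA0 : 0 < A := by positivity
  set ρ := κ * e / (4 * M) with hρ
  have hρ0 : 0 < ρ := by positivity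
  refine ⟨(2 * A / √k + a * X) / ρ, by positivity, ?_⟩
  intro c v w h t₀ t₁ ht hD he1
  have hc := h.pos_c
  set x : ℝ → ℝ := fun t => √(deficit s v w t) with hx
  have hx0 : ∀ t, 0 < x t := fun t => Real.sqrt_pos.2 (h.deficit_pos hs t)
  have hxX : ∀ t, x t ≤ X := fun t => Real.sqrt_le_sqrt (h.deficit_lt hs t).le
  have hxsq : ∀ t, x t ^ 2 = deficit s v w t := fun t => Real.sq_sqrt (h.deficit_pos hs t).le
  have hwW : ∀ t, |w t| ≤ W := fun t => by
    refine Real.abs_le_sqrt ?_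
    have h1 := h.deficit_pos hs t
    have h2 := wellPotential_nonneg hs (h.pos hs t).le (h.lt t)
    unfold deficit at h1
    linarith
  have hvx : ∀ t, κ * x t ≤ v t := fun t => by
    refine (abs_le_of_sq_le_sq' ?_ (h.pos hs t).le).2
    have h1 := depth_le hs hus (h.mem_Icc hs hW t)
    have h2 : x t ^ 2 ≤ P / 2 * v t ^ 2 := by
      rw [hxsq]; unfold deficit; nlinarith [sq_nonneg (w t)]
    have h3 : κ ^ 2 = 2 / P := Real.sq_sqrt (by positivity)
    rw [mul_pow, h3, div_mul_eq_mul_div, div_le_iff₀ hP0]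
    linarith
  set g : ℝ → ℝ := fun t => restoring s (v t) with hg
  have hgB : ∀ t, |g t| ≤ B := fun t => (hbound _ (h.mem_Icc hs hW t)).1
  set L : ℝ → ℝ := fun t => w t * g t / x t + a / c * x t + c / κ * Real.log (x t) -
    B * W * (x t)⁻¹ with hL
  have hLd : ∀ t, HasDerivAt L _ t := fun t => h.hasDerivAt_lyapunov hs a κ (B * W) t
  have hmono : MonotoneOn (fun t => L t - ρ * t) (Set.Iic t₁) := by
    refine monotoneOn_of_hasDerivAt (convex_Iic t₁) (fun t _ => (hLd t).sub
      ((hasDerivAt_id t).const_mul ρ)) fun t ht => ?_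
    have hen : e ≤ w t ^ 2 / 2 + 2 * M * g t ^ 2 := by
      have h1 := he1.trans (h.antitone_energy hs ht)
      have h2 := wellPotential_le hs hus hW.lt_end.le (h.mem_Icc hs hW t)
      have h3 := half_le_stiffness hs (h.lt t)
      have h4 : (v t - uPlus s) ^ 2 ≤ 4 * g t ^ 2 := by
        have : g t ^ 2 = (v t - uPlus s) ^ 2 * stiffness s (v t) ^ 2 := by
          simp only [hg, restoring]; ring
        rw [this]
        nlinarith [sq_nonneg (v t - uPlus s), mul_nonneg (sq_nonneg (v t - uPlus s))
          (show 0 ≤ stiffness s (v t) ^ 2 - 1 / 4 by nlinarith)]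
      have h5 : M / 2 * (v t - uPlus s) ^ 2 ≤ M / 2 * (4 * g t ^ 2) := by gcongr
      linarith
    have := lyapunov_bound hc (hx0 t) (hxX t) hκ0 hM0 (hgB t)
      (hbound _ (h.mem_Icc hs hW t)).2 (hwW t) (hvx t) hen
    rw [mul_one]
    linarith
  have hkey := hmono (Set.mem_Iic.2 ht) (Set.mem_Iic.2 le_rfl) ht
  simp only at hkey
  have hx01 : x t₀ ≤ x t₁ := Real.sqrt_le_sqrt (h.monotone_deficit hs ht)
  have hxt0 := hx0 t₀
  have hxt1 := hx0 t₁
  have hS : ∀ t, x t₀ ≤ x t → |w t * g t / x t| ≤ B * W / x t₀ := fun t hxt => by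
    rw [abs_div, abs_of_pos (hx0 t), abs_mul, mul_comm B W]
    exact div_le_div₀ (by positivity)
      (mul_le_mul (hwW t) (hgB t) (abs_nonneg _) hW0.le) hxt0 hxt
  have hlog : Real.log (x t₁) - Real.log (x t₀) ≤ X / x t₀ := by
    rw [← Real.log_div hxt1.ne' hxt0.ne']
    have h1 := Real.log_le_sub_one_of_pos (show 0 < x t₁ / x t₀ by positivity)
    have h2 : x t₁ / x t₀ ≤ X / x t₀ := by gcongr; exact hxX t₁
    linarith
  have hLL : L t₁ - L t₀ ≤ 3 * (B * W) / x t₀ + a / c * X + c / κ * (X / x t₀) := by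
    have h1 := (abs_le.1 (hS t₁ hx01)).2
    have h2 := (abs_le.1 (hS t₀ le_rfl)).1
    have h3 : c / κ * (Real.log (x t₁) - Real.log (x t₀)) ≤ c / κ * (X / x t₀) := by gcongr
    have h4 : a / c * x t₁ ≤ a / c * X := by gcongr; exact hxX t₁
    have h5 : 0 ≤ a / c * x t₀ := by positivity
    have h6 : 0 ≤ B * W * (x t₁)⁻¹ := by positivity
    have h7 : 3 * (B * W) / x t₀ = 3 * (B * W / x t₀) := by ring
    have h8 : B * W * (x t₀)⁻¹ = B * W / x t₀ := by ring
    simp only [hL]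
    rw [h7, h8]
    linarith
  have hfin := duration_bound_arith hc hk hxt0 (hxsq t₀ ▸ hD) (mul_pos hB hW0) hκ0 ha0 hX0
  rw [div_mul_eq_mul_div, le_div_iff₀ hρ0]
  linarith

/-- Below the level of the saddle the orbit is trapped away from the saddle. -/
lemma exists_trap {s : ℝ} (hs : 1 < s) {e : ℝ} (he : e < wellPotential s 0) :
    ∃ a, 0 < a ∧ a ≤ uPlus s ∧ ∀ {c : ℝ} {v w : ℝ → ℝ}, IsProfile s c v w → ∀ {t : ℝ},
      w t ^ 2 / 2 + wellPotential s (v t) ≤ e →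
      a ≤ v t ∧ a / 4 * (v t - uPlus s) ^ 2 ≤ wellPotential s (v t) := by
  obtain ⟨us, hus, hW⟩ := exists_isWell hs
  have hup := uPlus_pos hs
  have hst := half_le_stiffness hs hus
  set P := uPlus s * stiffness s us with hP
  have hP0 : 0 < P := mul_pos hup (by linarith)
  have h0 : 0 < 2 * (wellPotential s 0 - e) / P := div_pos (by linarith) hP0
  refine ⟨min (uPlus s) √(2 * (wellPotential s 0 - e) / P),
    lt_min hup (Real.sqrt_pos.2 h0), min_le_left _ _, ?_⟩
  intro c v w h t ht
  have h1 := depth_le hs hus (h.mem_Icc hs hW t)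
  have hle : min (uPlus s) √(2 * (wellPotential s 0 - e) / P) ≤ v t := by
    refine (min_le_right _ _).trans ?_
    rw [Real.sqrt_le_left (h.pos hs t).le, div_le_iff₀ hP0]
    nlinarith [sq_nonneg (w t)]
  exact ⟨hle, le_wellPotential hs hus hW.lt_end.le (lt_min hup (Real.sqrt_pos.2 h0))
    (min_le_left _ _) ⟨hle, (h.mem_Icc hs hW t).2⟩⟩

/-- The bound for the derivative of the function `E + c γ w (v - u₊)` in `exists_decay`, with
`z = v - u₊`, force `f = φ(v)` and value `L`. -/
lemma decay_bound {c c₁ γ κ μ M w z f L : ℝ} (hc : 0 < c) (hcc : c ≤ c₁) (hμ : 0 < μ) (hγ : 0 < γ)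
    (hκ : 0 < κ) (hγ1 : γ * (1 + c₁ ^ 2 / (4 * μ)) ≤ 1 / 2) (hκ1 : κ ≤ 1 / 2)
    (hκ2 : κ * (M + μ) ≤ γ * μ) (hL : L ≤ w ^ 2 + (M + μ) * z ^ 2) (hf : 2 * μ * z ^ 2 ≤ f * z) :
    -(w ^ 2) + γ * ((-(c * w) - f) * z + w * w) + κ * L ≤ 0 := by
  have hwz : -(c * w * z) ≤ μ * z ^ 2 + c₁ ^ 2 / (4 * μ) * w ^ 2 := by
    have h3 : μ * z ^ 2 + c ^ 2 / (4 * μ) * w ^ 2 + c * w * z =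
        μ * (z + c * w / (2 * μ)) ^ 2 := by
      field_simp
      ring
    have h4 : 0 ≤ μ * (z + c * w / (2 * μ)) ^ 2 := by positivity
    have h5 : c ^ 2 / (4 * μ) * w ^ 2 ≤ c₁ ^ 2 / (4 * μ) * w ^ 2 := by gcongr
    linarith
  have h3 : γ * ((-(c * w) - f) * z + w * w) ≤
      γ * ((1 + c₁ ^ 2 / (4 * μ)) * w ^ 2 - μ * z ^ 2) := by
    refine mul_le_mul_of_nonneg_left ?_ hγ.le
    have : (-(c * w) - f) * z + w * w = -(c * w * z) - f * z + w ^ 2 := by ring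
    linarith
  have h4 : γ * (1 + c₁ ^ 2 / (4 * μ)) * w ^ 2 ≤ 1 / 2 * w ^ 2 := by gcongr
  have h5 : κ * L ≤ κ * (w ^ 2 + (M + μ) * z ^ 2) := by gcongr
  have h6 : κ * (M + μ) * z ^ 2 ≤ γ * μ * z ^ 2 := by gcongr
  have h7 : κ * w ^ 2 ≤ 1 / 2 * w ^ 2 := by gcongr
  linarith

/-- Once the energy is below the level of the saddle, it decays exponentially: for small `γ` the
function `E + c γ w (v - u₊)` is comparable to `E` and decays at a rate proportional to `c`. -/
lemma exists_decay {s : ℝ} (hs : 1 < s) {e c₁ : ℝ} (he0 : 0 < e) (he : e < wellPotential s 0)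
    (hc₁ : 0 < c₁) :
    ∃ C κ, 0 < C ∧ 0 < κ ∧ ∀ {c : ℝ} {v w : ℝ → ℝ}, IsProfile s c v w → c ≤ c₁ → ∀ {T : ℝ},
      w T ^ 2 / 2 + wellPotential s (v T) ≤ e → ∀ {t : ℝ}, T ≤ t →
      w t ^ 2 / 2 + wellPotential s (v t) ≤ C * Real.exp (-(κ * c * (t - T))) := by
  obtain ⟨us, hus, hW⟩ := exists_isWell hs
  obtain ⟨a, ha, hau, htrap⟩ := exists_trap hs he
  have hup := uPlus_pos hs
  have hus0 : 0 < us := hup.trans hW.lt_end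
  have hst := half_le_stiffness hs hus
  set M := us * stiffness s us with hM
  have hM0 : 0 < M := mul_pos hus0 (by linarith)
  set μ := a / 4 with hμ
  have hμ0 : 0 < μ := by positivity
  -- The first bound on `γ` makes the derivative negative definite in `(w, v - u₊)`, the second
  -- makes the perturbed energy comparable to the energy.
  set γ := min (1 / 2 / (1 + c₁ ^ 2 / (4 * μ))) (min (1 / 2) μ / c₁) with hγ
  have hγ0 : 0 < γ := by positivity
  have hγ1 : γ * (1 + c₁ ^ 2 / (4 * μ)) ≤ 1 / 2 := by
    rw [← le_div_iff₀ (by positivity)]; exact min_le_left _ _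
  have hγ2 : γ * c₁ ≤ min (1 / 2) μ := by
    rw [← le_div_iff₀ hc₁]; exact min_le_right _ _
  have hγ3 : γ * c₁ ≤ 1 / 2 := hγ2.trans (min_le_left _ _)
  have hγ4 : γ * c₁ ≤ μ := hγ2.trans (min_le_right _ _)
  set κ := min (1 / 2) (γ * μ / (M + μ)) with hκ
  have hκ0 : 0 < κ := by positivity
  have hκ1 : κ ≤ 1 / 2 := min_le_left _ _
  have hκ2 : κ * (M + μ) ≤ γ * μ := by
    rw [← le_div_iff₀ (by positivity)]; exact min_le_right _ _
  refine ⟨4 * e, κ, by positivity, hκ0, ?_⟩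
  intro c v w h hcc T hT t ht
  have hc := h.pos_c
  set E : ℝ → ℝ := fun t => w t ^ 2 / 2 + wellPotential s (v t) with hE
  set L : ℝ → ℝ := fun t => E t + c * γ * (w t * (v t - uPlus s)) with hL
  have hsmall : ∀ t, |c * γ * (w t * (v t - uPlus s))| ≤
      w t ^ 2 / 4 + μ / 2 * (v t - uPlus s) ^ 2 := fun t => by
    set z := v t - uPlus s
    have h1 : |w t * z| ≤ (w t ^ 2 + z ^ 2) / 2 := by
      rw [abs_le]; constructor <;> nlinarith [sq_nonneg (w t - z), sq_nonneg (w t + z)]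
    rw [abs_mul, abs_of_pos (by positivity : 0 < c * γ)]
    have h2 : c * γ ≤ γ * c₁ := by nlinarith
    calc c * γ * |w t * z| ≤ γ * c₁ * ((w t ^ 2 + z ^ 2) / 2) := by gcongr
      _ = γ * c₁ * (w t ^ 2 / 2) + γ * c₁ * (z ^ 2 / 2) := by ring
      _ ≤ 1 / 2 * (w t ^ 2 / 2) + μ * (z ^ 2 / 2) := by gcongr
      _ = _ := by ring
  have hEt : ∀ t, T ≤ t → a ≤ v t ∧ μ * (v t - uPlus s) ^ 2 ≤ wellPotential s (v t) :=
    fun t ht => htrap h ((h.antitone_energy hs ht).trans hT)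
  have hLE : ∀ t, T ≤ t → E t ≤ 2 * L t ∧ L t ≤ 2 * E t := fun t ht => by
    have h1 := abs_le.1 (hsmall t)
    have h2 := (hEt t ht).2
    simp only [hL, hE]
    constructor <;> linarith [sq_nonneg (w t)]
  have hLd : ∀ t, HasDerivAt L (-(c * w t ^ 2) + c * γ * ((-(c * w t) - phi s (v t)) *
      (v t - uPlus s) + w t * w t)) t := fun t => by
    refine ((((h.hw t).pow 2).div_const 2).add (h.hasDerivAt_potential hs t) |>.add
      (((h.hw t).mul ((h.hv t).sub_const (uPlus s))).const_mul (c * γ))).congr_deriv ?_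
    norm_num
    ring
  have hmono : MonotoneOn (fun t => -(L t * Real.exp (κ * c * t))) (Set.Ici T) := by
    refine monotoneOn_of_hasDerivAt (convex_Ici T) (fun t _ => ((hLd t).mul
      (((hasDerivAt_id t).const_mul (κ * c)).exp)).neg) fun t ht => ?_
    obtain ⟨hav, hpot⟩ := hEt t ht
    have h1 := (abs_le.1 (hsmall t)).2
    have h2 := wellPotential_le hs hus hW.lt_end.le (h.mem_Icc hs hW t)
    have hk := half_le_stiffness hs (h.lt t)
    set z := v t - uPlus s with hz
    have hvk : 2 * μ ≤ v t * stiffness s (v t) := by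
      have : a * (1 / 2) ≤ v t * stiffness s (v t) :=
        mul_le_mul hav hk (by norm_num) (h.pos hs t).le
      linarith
    have hLup : L t ≤ w t ^ 2 + (M + μ) * z ^ 2 := by
      simp only [hL, hE]
      have := sq_nonneg (w t)
      have := mul_nonneg hμ0.le (sq_nonneg z)
      have := mul_nonneg hM0.le (sq_nonneg z)
      linarith
    have hphi : 2 * μ * z ^ 2 ≤ phi s (v t) * z := by
      rw [phi_eq hs (h.lt t)]
      nlinarith [mul_le_mul_of_nonneg_right hvk (sq_nonneg z)]
    have hmain := decay_bound hc hcc hμ0 hγ0 hκ0 hγ1 hκ1 hκ2 hLup hphi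
    have e1 : -((-(c * w t ^ 2) + c * γ * ((-(c * w t) - phi s (v t)) * z + w t * w t)) *
        Real.exp (κ * c * id t) + L t * (Real.exp (κ * c * id t) * (κ * c * 1))) =
        c * -(-(w t ^ 2) + γ * ((-(c * w t) - phi s (v t)) * z + w t * w t) + κ * L t) *
        Real.exp (κ * c * id t) := by ring
    rw [e1]
    exact mul_nonneg (mul_nonneg hc.le (by linarith)) (Real.exp_pos _).le
  have hkey := hmono (Set.mem_Ici.2 le_rfl) (Set.mem_Ici.2 ht) ht
  simp only [neg_le_neg_iff] at hkey
  have h1 := (hLE t ht).1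
  have h2 := (hLE T le_rfl).2
  have h3 : L t ≤ L T * Real.exp (-(κ * c * (t - T))) := by
    have e1 : -(κ * c * (t - T)) = κ * c * T + -(κ * c * t) := by ring
    rw [e1, Real.exp_add, ← mul_assoc]
    calc L t = L t * Real.exp (κ * c * t) * Real.exp (-(κ * c * t)) := by
          rw [mul_assoc, ← Real.exp_add]; simp
      _ ≤ _ := by gcongr
  have hET : E T ≤ e := hT
  calc E t ≤ 2 * L t := h1
    _ ≤ 2 * (L T * Real.exp (-(κ * c * (t - T)))) := by gcongr
    _ ≤ 2 * (2 * e * Real.exp (-(κ * c * (t - T)))) := by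
        gcongr
        linarith
    _ = _ := by ring

/-! ### The crest of an undular bore -/

namespace IsProfile

variable {s c : ℝ} {v w : ℝ → ℝ}

/-- Sturm's comparison: where `φ(v) / (v - u₊) ≥ c ^ 2 / 4 + ω ^ 2`, a profile does not stay on one
side of `u₊` for longer than `π / ω`. The Prüfer angle
`arctan ((w / (v - u₊) + c / 2) / ω)` decreases at least at the rate `ω`. -/
lemma length_le_of_ne (h : IsProfile s c v w) (hs : 1 < s) {ω a b : ℝ} (hω : 0 < ω) (hab : a ≤ b)
    (hne : ∀ t ∈ Set.Icc a b, v t ≠ uPlus s)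
    (hQ : ∀ t ∈ Set.Icc a b, c ^ 2 / 4 + ω ^ 2 ≤ v t * stiffness s (v t)) :
    b - a ≤ Real.pi / ω := by
  have hd : ∀ t ∈ Set.Icc a b, HasDerivAt
      (fun t => -Real.arctan ((w t / (v t - uPlus s) + c / 2) / ω) - ω * t)
      (-(1 / (1 + ((w t / (v t - uPlus s) + c / 2) / ω) ^ 2) *
        (((-(c * w t) - phi s (v t)) * (v t - uPlus s) - w t * w t) / (v t - uPlus s) ^ 2 / ω)) -
        ω * 1) t := fun t ht => by
    have hz : v t - uPlus s ≠ 0 := sub_ne_zero.2 (hne t ht)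
    exact ((((h.hw t).div ((h.hv t).sub_const (uPlus s)) hz).add_const (c / 2)).div_const
      ω).arctan.neg.sub ((hasDerivAt_id t).const_mul ω)
  have hmono := monotoneOn_of_hasDerivAt (convex_Icc a b) hd fun t ht => by
    have hz : v t - uPlus s ≠ 0 := sub_ne_zero.2 (hne t ht)
    have hq := hQ t ht
    rw [phi_eq hs (h.lt t)]
    set p := w t / (v t - uPlus s) with hp
    have e : ((-(c * w t) - v t * (v t - uPlus s) * stiffness s (v t)) * (v t - uPlus s) -
        w t * w t) / (v t - uPlus s) ^ 2 =
        -((p + c / 2) ^ 2 + (v t * stiffness s (v t) - c ^ 2 / 4)) := by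
      rw [hp]
      field_simp
      ring
    rw [e, mul_one]
    have e2 : 1 / (1 + ((p + c / 2) / ω) ^ 2) = ω ^ 2 / (ω ^ 2 + (p + c / 2) ^ 2) := by
      field_simp
    have e3 : -(1 / (1 + ((p + c / 2) / ω) ^ 2) *
        (-((p + c / 2) ^ 2 + (v t * stiffness s (v t) - c ^ 2 / 4)) / ω)) =
        ω * ((p + c / 2) ^ 2 + (v t * stiffness s (v t) - c ^ 2 / 4)) /
          (ω ^ 2 + (p + c / 2) ^ 2) := by
      rw [e2]
      field_simp
    rw [e3, sub_nonneg, le_div_iff₀ (by positivity)]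
    exact mul_le_mul_of_nonneg_left (by linarith) hω.le
  have := hmono (Set.left_mem_Icc.2 hab) (Set.right_mem_Icc.2 hab) hab
  simp only at this
  have h1 := Real.neg_pi_div_two_lt_arctan ((w b / (v b - uPlus s) + c / 2) / ω)
  have h2 := Real.arctan_lt_pi_div_two ((w a / (v a - uPlus s) + c / 2) / ω)
  rw [le_div_iff₀ hω]
  linarith

lemma w_eq_zero_of_max (h : IsProfile s c v w) {t : ℝ} (ht : IsLocalMax v t) : w t = 0 :=
  ht.hasDerivAt_eq_zero (h.hv t)

lemma continuousAt_slope {u : ℝ} (hu : u < s) : ContinuousAt (fun u => u * stiffness s u) u := by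
  have : s - u ≠ 0 := by linarith
  unfold stiffness
  refine continuousAt_id.mul (continuousAt_const.add (continuousAt_const.div ?_ (by simpa)))
  fun_prop

/-- Below the critical friction the profile overshoots. -/
lemma exists_gt (h : IsProfile s c v w) (hs : 1 < s) (hc : c ^ 2 < 4 * alpha s) :
    ∃ t, uPlus s < v t := by
  by_contra! hle
  have hne : ∀ t, v t ≠ uPlus s := fun t ht => by
    have hmax : IsLocalMax v t := Eventually.of_forall fun x => ht ▸ hle x
    exact h.not_equilibrium hs (h.w_eq_zero_of_max hmax)
      ((phi_eq_zero_iff hs (h.lt t)).2 (Or.inr ht))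
  set ω := √((alpha s - c ^ 2 / 4) / 2) with hω
  have hω0 : 0 < ω := Real.sqrt_pos.2 (by linarith)
  have hω2 : ω ^ 2 = (alpha s - c ^ 2 / 4) / 2 := Real.sq_sqrt (by linarith)
  have hlim : Tendsto (fun t => v t * stiffness s (v t)) atTop (𝓝 (alpha s)) := by
    rw [alpha_eq_stiffness hs]
    exact (continuousAt_slope (uPlus_lt hs)).tendsto.comp h.top
  obtain ⟨T, hT⟩ := eventually_atTop.1
    (hlim.eventually_const_lt (show c ^ 2 / 4 + ω ^ 2 < alpha s by linarith))
  have hpi : 0 < Real.pi / ω := div_pos Real.pi_pos hω0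
  have := h.length_le_of_ne hs hω0 (show T ≤ T + (Real.pi / ω + 1) by linarith)
    (fun t _ => hne t) fun t ht => (hT t ht.1).le
  linarith

/-- Below the critical friction the profile has a crest, and only one, since the energy strictly
decreases. -/
lemma exists_crest (h : IsProfile s c v w) (hs : 1 < s) (hc : c ^ 2 < 4 * alpha s) :
    ∃ t₀, ∀ t ≠ t₀, v t < v t₀ := by
  obtain ⟨t₁, ht₁⟩ := h.exists_gt hs hc
  obtain ⟨t₀, ht₀⟩ := h.continuous_v.exists_forall_ge' t₁ (by
    rw [cocompact_eq_atBot_atTop, eventually_sup]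
    exact ⟨(h.bot.eventually_lt_const ((uPlus_pos hs).trans ht₁)).mono fun _ hx => hx.le,
      (h.top.eventually_lt_const ht₁).mono fun _ hx => hx.le⟩)
  refine ⟨t₀, fun t hne => lt_of_le_of_ne (ht₀ t) fun heq => hne ?_⟩
  have hw0 := h.w_eq_zero_of_max (t := t₀) (Eventually.of_forall ht₀)
  have hw1 := h.w_eq_zero_of_max (t := t) (Eventually.of_forall fun x => heq ▸ ht₀ x)
  refine (h.strictMono_deficit hs).injective ?_
  unfold deficit
  rw [hw0, hw1, heq]

/-- Before the crest the profile crosses the level `u₊` only once, since at an earlier local maximum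
the energy would be larger than at the crest. -/
lemma lt_of_mem_Ioc_crest (h : IsProfile s c v w) (hs : 1 < s) {z t₀ : ℝ}
    (hcrest : ∀ t ≠ t₀, v t < v t₀) (hz : v z = uPlus s) (hlt : ∀ x < z, v x < uPlus s) {x : ℝ}
    (hx : x ∈ Set.Ioc z t₀) : uPlus s < v x := by
  have hle : ∀ t, v t ≤ v t₀ := fun t => by
    rcases eq_or_ne t t₀ with rfl | ht
    · exact le_rfl
    · exact (hcrest t ht).le
  have hw0 := h.w_eq_zero_of_max (t := t₀) (Eventually.of_forall hle)
  by_contra hvx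
  rw [not_lt] at hvx
  by_cases hall : ∀ y ∈ Set.Icc z x, v y ≤ uPlus s
  · -- then `z` itself is a local maximum at the level of the equilibrium
    have hmax : IsLocalMax v z := by
      filter_upwards [Iio_mem_nhds hx.1] with y hy
      rw [hz]
      rcases lt_or_ge y z with hyz | hyz
      · exact (hlt y hyz).le
      · exact hall y ⟨hyz, le_of_lt hy⟩
    exact h.not_equilibrium hs (h.w_eq_zero_of_max hmax)
      ((phi_eq_zero_iff hs (h.lt z)).2 (Or.inr hz))
  · push Not at hall
    obtain ⟨y₀, hy₀, hvy₀⟩ := hall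
    obtain ⟨y, hy, hymax⟩ := isCompact_Icc.exists_isMaxOn ⟨y₀, hy₀⟩ h.continuous_v.continuousOn
    have hvy : uPlus s < v y := hvy₀.trans_le (hymax hy₀)
    have hy1 : z < y := lt_of_le_of_ne hy.1 fun e => by rw [← e, hz] at hvy; exact hvy.false
    have hy2 : y < x := lt_of_le_of_ne hy.2 fun e => by rw [e] at hvy; linarith
    have hwy := h.w_eq_zero_of_max (hymax.isLocalMax (Icc_mem_nhds hy1 hy2))
    have hD := h.strictMono_deficit hs (hy2.trans_le hx.2)
    unfold deficit at hD
    rw [hw0, hwy] at hD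
    have := (wellPotential_strictMonoOn hs).monotoneOn ⟨hvy.le, h.lt y⟩
      ⟨hvy.le.trans (hle y), h.lt t₀⟩ (hle y)
    linarith

end IsProfile

lemma exists_energy_small {s : ℝ} (hs : 1 < s) {θ : ℝ} (hθ : 0 < θ) :
    ∃ e, 0 < e ∧ ∀ {c : ℝ} {v w : ℝ → ℝ}, IsProfile s c v w → ∀ {t : ℝ},
      w t ^ 2 / 2 + wellPotential s (v t) ≤ e → |v t - uPlus s| < θ := by
  have hE := wellPotential_zero_pos hs
  obtain ⟨a, ha, -, htrap⟩ := exists_trap hs (half_lt_self hE)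
  refine ⟨min (wellPotential s 0 / 2) (a / 8 * θ ^ 2), by positivity, ?_⟩
  intro c v w h t ht
  have h1 := (htrap h (ht.trans (min_le_left _ _))).2
  have h2 := ht.trans (min_le_right _ _)
  refine abs_lt_of_sq_lt_sq ?_ hθ.le
  have h3 : a * (v t - uPlus s) ^ 2 ≤ a * (θ ^ 2 / 2) := by nlinarith [sq_nonneg (w t)]
  have h4 := le_of_mul_le_mul_left h3 ha
  have : 0 < θ ^ 2 := by positivity
  linarith

lemma two_le_add_inv {c : ℝ} (hc : 0 < c) : 2 ≤ c + 1 / c := by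
  have : c + 1 / c - 2 = (c - 1) ^ 2 / c := by
    field_simp
    ring
  have : 0 ≤ (c - 1) ^ 2 / c := by positivity
  linarith

/-- Uniformly below a friction smaller than the critical one, the time from the front to the crest
is at most of order `c + 1 / c`. -/
lemma exists_front_to_crest {s : ℝ} (hs : 1 < s) {q : ℝ} (hq : q < 1) :
    ∃ C, 0 < C ∧ ∀ {c : ℝ} {v w : ℝ → ℝ}, IsProfile s c v w → c ^ 2 ≤ 4 * (q * alpha s) →
      ∀ {t₀ t₁ : ℝ}, v t₀ = uPlus s / 2 → (∀ x < t₀, v x < uPlus s / 2) →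
      (∀ t ≠ t₁, v t < v t₁) → t₀ ≤ t₁ ∧ t₁ ≤ t₀ + C * (c + 1 / c) := by
  have hup := uPlus_pos hs
  have hα := alpha_pos hs
  set η := (1 - q) * alpha s / 2 with hη
  have hη0 : 0 < η := by
    have : 0 < 1 - q := by linarith
    positivity
  set ω := √η with hω
  have hω0 : 0 < ω := Real.sqrt_pos.2 hη0
  have hω2 : ω ^ 2 = η := Real.sq_sqrt hη0.le
  obtain ⟨ρ, hρ, hclose⟩ := Metric.continuousAt_iff.1
    (IsProfile.continuousAt_slope (uPlus_lt hs)) η hη0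
  obtain ⟨e, he, hsmall⟩ := exists_energy_small hs hρ
  have hk : 0 < min 1 ((uPlus s - uPlus s / 2) / 2) / 2 * (uPlus s / 2) ^ 2 := by
    have : 0 < (uPlus s - uPlus s / 2) / 2 := by linarith
    positivity
  obtain ⟨C, hC, hdur⟩ := exists_duration_bound hs he hk
  have hpi : 0 < Real.pi / ω := div_pos Real.pi_pos hω0
  refine ⟨C + 1 + (Real.pi / ω + 1), by positivity, ?_⟩
  intro c v w h hcq t₀ t₁ hv₀ hlt hcrest
  have hc := h.pos_c
  have hcc := two_le_add_inv hc
  have hcα : c ^ 2 < 4 * alpha s := by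
    have : q * alpha s < 1 * alpha s := by gcongr
    linarith
  obtain ⟨t₂, ht₂⟩ := h.exists_gt hs hcα
  have hv₁ : uPlus s < v t₁ := by
    rcases eq_or_ne t₂ t₁ with rfl | hne
    · exact ht₂
    · exact ht₂.trans (hcrest t₂ hne)
  refine ⟨?_, ?_⟩
  · by_contra hcon
    have := hlt t₁ (not_le.1 hcon)
    linarith
  -- At the time `T` the energy is small enough for Sturm's comparison to apply from then on. After
  -- `T` the orbit is first below `u₊`, up to the time `z`, then above `u₊`, up to the crest `t₁`.
  set T := t₀ + (C + 1) * (c + 1 / c) with hT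
  have hT₀ : t₀ ≤ T := by
    have : 0 ≤ (C + 1) * (c + 1 / c) := by positivity
    linarith
  have hET : w T ^ 2 / 2 + wellPotential s (v T) ≤ e := by
    by_contra hcon
    have := hdur h hT₀ (h.deficit_of_first hs (by linarith) hv₀ hlt) (not_le.1 hcon).le
    rw [hT] at this
    linarith
  have hQ : ∀ t, T ≤ t → c ^ 2 / 4 + ω ^ 2 ≤ v t * stiffness s (v t) := fun t ht => by
    have h1 := hsmall h ((h.antitone_energy hs ht).trans hET)
    rw [← Real.dist_eq] at h1
    have h2 := hclose h1
    rw [Real.dist_eq, ← alpha_eq_stiffness hs] at h2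
    have h3 := (abs_lt.1 h2).1
    rw [hω2]
    have : alpha s - η = q * alpha s + η := by rw [hη]; ring
    linarith
  obtain ⟨z, hz, hltz⟩ := h.exists_first hup ⟨t₁, hv₁.le⟩
  have hz1 : z ≤ t₁ := by
    by_contra hcon
    have := hltz t₁ (not_le.1 hcon)
    linarith
  have hb1 : z ≤ T + Real.pi / ω + 1 := by
    by_contra! hcon
    have := h.length_le_of_ne hs hω0 (show T ≤ z - 1 by linarith)
      (fun t ht => (hltz t (by linarith [ht.2])).ne) fun t ht => hQ t ht.1
    linarith
  have hb2 : t₁ ≤ max T (z + 1) + Real.pi / ω := by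
    by_contra! hcon
    have := h.length_le_of_ne hs hω0 (show max T (z + 1) ≤ t₁ by linarith)
      (fun t ht => (h.lt_of_mem_Ioc_crest hs hcrest hz hltz
        ⟨by linarith [ht.1, le_max_right T (z + 1)], ht.2⟩).ne')
      fun t ht => hQ t ((le_max_left _ _).trans ht.1)
    linarith
  have hb3 : max T (z + 1) ≤ T + Real.pi / ω + 2 := max_le (by linarith) (by linarith)
  have hb4 : (Real.pi / ω + 1) * 2 ≤ (Real.pi / ω + 1) * (c + 1 / c) := by gcongr
  have : t₀ + (C + 1 + (Real.pi / ω + 1)) * (c + 1 / c) =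
    T + (Real.pi / ω + 1) * (c + 1 / c) := by rw [hT]; ring
  linarith

/-- Up to the precision `θ`, and outside a time interval of length of order `c + 1 / c` around `t₀`,
the profile `v` is a jump from `0` to `u₊`. -/
def NearJump (s θ C c : ℝ) (v : ℝ → ℝ) (t₀ : ℝ) : Prop :=
  ∀ t, (t ≤ t₀ - C * (c + 1 / c) → v t < θ) ∧
    (t₀ + C * (c + 1 / c) ≤ t → |v t - uPlus s| < θ)

lemma exists_nearJump_front {s : ℝ} (hs : 1 < s) {m θ : ℝ} (hm : 0 < m) (hm' : m < uPlus s)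
    (hθ : 0 < θ) :
    ∃ C, 0 < C ∧ ∀ {c : ℝ} {v w : ℝ → ℝ}, IsProfile s c v w → ∀ {t₀ : ℝ}, v t₀ = m →
      (∀ x < t₀, v x < m) → NearJump s θ C c v t₀ := by
  obtain ⟨e, he, hsmall⟩ := exists_energy_small hs hθ
  set b := min 1 ((uPlus s - m) / 2) with hb
  have hb0 : 0 < b := by
    have : 0 < (uPlus s - m) / 2 := by linarith
    positivity
  have hk : 0 < b / 2 * m ^ 2 := by positivity
  obtain ⟨C, hC, hdur⟩ := exists_duration_bound hs he hk
  refine ⟨C + 1 + 2 * m / (b * θ), by positivity, ?_⟩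
  intro c v w h t₀ hv hlt t
  have hc := h.pos_c
  have hcc := two_le_add_inv hc
  set A := C + 1 + 2 * m / (b * θ) with hA
  have hA0 : 0 < A := by positivity
  have hA1 : C + 1 ≤ A := by
    have : 0 < 2 * m / (b * θ) := by positivity
    linarith
  have hA2 : 2 * m / (b * θ) ≤ A := by linarith
  constructor
  · intro ht
    have hpos : 0 < A * (c + 1 / c) := by positivity
    have h1 := h.front_decay hs hm' (le_of_first hv hlt) (show t ≤ t₀ by linarith)
    rw [hv] at h1
    refine h1.trans_lt ?_
    have h2 : m / θ ≤ frontRate s m c * (t₀ - t) := by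
      have h3 : frontRate s m c * (A * (c + 1 / c)) ≤ frontRate s m c * (t₀ - t) :=
        mul_le_mul_of_nonneg_left (by linarith) (frontRate_pos hm' hc).le
      refine le_trans ?_ h3
      have h4 : 1 / 2 ≤ 1 / (1 + c) * (c + 1 / c) := by
        rw [one_div_mul_eq_div, le_div_iff₀ (by linarith)]
        have : 0 < 1 / c := by positivity
        linarith
      calc m / θ = b * (2 * m / (b * θ)) * (1 / 2) := by field_simp
        _ ≤ b * A * (1 / (1 + c) * (c + 1 / c)) := by gcongr
        _ = _ := by rw [frontRate, ← hb]; ring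
    have h3 : m / θ < Real.exp (frontRate s m c * (t₀ - t)) := by
      have := Real.add_one_le_exp (frontRate s m c * (t₀ - t))
      linarith
    rw [Real.exp_neg, ← div_eq_mul_inv, div_lt_iff₀ (Real.exp_pos _)]
    rw [div_lt_iff₀ hθ] at h3
    linarith
  · intro ht
    refine hsmall h ?_
    by_contra hcon
    have h0 : (C + 1) * (c + 1 / c) ≤ A * (c + 1 / c) := by gcongr
    have h1 : 0 ≤ (C + 1) * (c + 1 / c) := by positivity
    have := hdur h (show t₀ ≤ t by linarith) (h.deficit_of_first hs hm' hv hlt)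
      (not_le.1 hcon).le
    linarith

lemma exists_nearJump_crest {s : ℝ} (hs : 1 < s) {q θ : ℝ} (hq : q < 1) (hθ : 0 < θ) :
    ∃ C, 0 < C ∧ ∀ {c : ℝ} {v w : ℝ → ℝ}, IsProfile s c v w → c ^ 2 ≤ 4 * (q * alpha s) →
      ∀ {t₁ : ℝ}, (∀ t ≠ t₁, v t < v t₁) → NearJump s θ C c v t₁ := by
  have hup := uPlus_pos hs
  obtain ⟨C₁, hC₁, h₁⟩ := exists_nearJump_front hs (half_pos hup) (half_lt_self hup) hθ
  obtain ⟨C₂, hC₂, h₂⟩ := exists_front_to_crest hs hq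
  refine ⟨C₁ + C₂, by positivity, ?_⟩
  intro c v w h hcq t₁ hcrest t
  have hc := h.pos_c
  have hcc := two_le_add_inv hc
  obtain ⟨t₀, ht₀, hlt⟩ := h.exists_first_of_lt (half_pos hup) (half_lt_self hup)
  obtain ⟨h3, h4⟩ := h₂ h hcq ht₀ hlt hcrest
  have h5 := h₁ h ht₀ hlt t
  have h6 : 0 < C₂ * (c + 1 / c) := by positivity
  exact ⟨fun ht => h5.1 (by linarith), fun ht => h5.2 (by linarith)⟩

/-! ### Reduction of traveling waves -/

/-- If `f` has arbitrarily long intervals on which it is nearly constant and on which the derivative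
of `a f' - b f` is near `K`, then `K = 0`. -/
lemma eq_zero_of_near_const {f f' g : ℝ → ℝ} {a b ℓ K : ℝ} (ha : 0 ≤ a) (hb : 0 ≤ b)
    (hf : ∀ x, HasDerivAt f (f' x) x) (hg : ∀ x, HasDerivAt (fun x => a * f' x - b * f x) (g x) x)
    (h : ∀ θ > 0, ∃ x, ∀ y ∈ Set.Icc x (x + 3), |f y - ℓ| < θ ∧ |g y - K| < θ) : K = 0 := by
  have key : ∀ θ > 0, |K| ≤ (1 + 4 * a + 2 * b) * θ := by
    intro θ hθ
    obtain ⟨x, hx⟩ := h θ hθ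
    have hslope : ∀ y, x ≤ y → y + 1 ≤ x + 3 → ∃ z ∈ Set.Ioo y (y + 1), |f' z| ≤ 2 * θ := by
      intro y hy hy'
      obtain ⟨z, hz, hzf⟩ := exists_hasDerivAt_eq_slope f f' (show y < y + 1 by linarith)
        (fun x _ => (hf x).continuousAt.continuousWithinAt) (fun x _ => hf x)
      refine ⟨z, hz, ?_⟩
      have h1 := abs_lt.1 (hx y ⟨hy, by linarith⟩).1
      have h2 := abs_lt.1 (hx (y + 1) ⟨by linarith, hy'⟩).1
      rw [hzf, show y + 1 - y = 1 by ring, div_one, abs_le]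
      constructor <;> linarith
    obtain ⟨z₁, hz₁, hz₁'⟩ := hslope x le_rfl (by linarith)
    obtain ⟨z₂, hz₂, hz₂'⟩ := hslope (x + 2) (by linarith) (by linarith)
    have hlt : z₁ < z₂ := by linarith [hz₁.2, hz₂.1]
    obtain ⟨y, hy, hyg⟩ := exists_hasDerivAt_eq_slope (fun x => a * f' x - b * f x) g hlt
      (fun x _ => (hg x).continuousAt.continuousWithinAt) (fun x _ => hg x)
    rw [eq_div_iff (by linarith)] at hyg
    have h1 := abs_lt.1 (hx z₁ ⟨hz₁.1.le, by linarith [hz₁.2]⟩).1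
    have h2 := abs_lt.1 (hx z₂ ⟨by linarith [hz₂.1], by linarith [hz₂.2]⟩).1
    have h3 : |g y| ≤ 4 * a * θ + 2 * b * θ := by
      have h4 : |g y| * 1 ≤ |g y| * (z₂ - z₁) := by
        gcongr
        linarith [hz₁.2, hz₂.1]
      have h5 : |g y| * (z₂ - z₁) = |g y * (z₂ - z₁)| := by
        rw [abs_mul, abs_of_pos (by linarith : 0 < z₂ - z₁)]
      have h6 : |a * f' z₂ - b * f z₂ - (a * f' z₁ - b * f z₁)| ≤ 4 * a * θ + 2 * b * θ := by
        have e : a * f' z₂ - b * f z₂ - (a * f' z₁ - b * f z₁) =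
          a * (f' z₂ - f' z₁) - b * (f z₂ - f z₁) := by ring
        rw [e]
        have i1 := abs_le.1 hz₁'
        have i2 := abs_le.1 hz₂'
        have i3 : |f' z₂ - f' z₁| ≤ 4 * θ := abs_le.2 ⟨by linarith, by linarith⟩
        have i4 : |f z₂ - f z₁| ≤ 2 * θ := abs_le.2 ⟨by linarith, by linarith⟩
        calc _ ≤ |a * (f' z₂ - f' z₁)| + |b * (f z₂ - f z₁)| := abs_sub _ _
          _ = a * |f' z₂ - f' z₁| + b * |f z₂ - f z₁| := by
            rw [abs_mul, abs_mul, abs_of_nonneg ha, abs_of_nonneg hb]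
          _ ≤ a * (4 * θ) + b * (2 * θ) := by gcongr
          _ = _ := by ring
      rw [h5, hyg] at h4
      linarith
    have h4 := abs_lt.1 (hx y ⟨by linarith [hy.1, hz₁.1], by linarith [hy.2, hz₂.2]⟩).2
    have h5 := abs_le.1 h3
    rw [abs_le]
    constructor <;> linarith
  by_contra hK
  have hpos := abs_pos.2 hK
  have := key (|K| / (2 * (1 + 4 * a + 2 * b))) (by positivity)
  have e : (1 + 4 * a + 2 * b) * (|K| / (2 * (1 + 4 * a + 2 * b))) = |K| / 2 := by
    field_simp
  linarith

lemma eq_const_of_hasDerivAt_zero {f : ℝ → ℝ} (hf : ∀ x, HasDerivAt f 0 x) {l : Filter ℝ} [l.NeBot]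
    {a : ℝ} (hl : Tendsto f l (𝓝 a)) (x : ℝ) : f x = a := by
  have hc : f = fun _ => f x := funext fun y =>
    is_const_of_deriv_eq_zero (fun x => (hf x).differentiableAt) (fun x => (hf x).deriv) y x
  rw [hc] at hl
  exact tendsto_nhds_unique tendsto_const_nhds hl

namespace IsTravelingWave

variable {s ε δ ηp up : ℝ} {N U : ℝ → ℝ}

lemma contDiff_N (h : IsTravelingWave s ε δ ηp up N U) : ContDiff ℝ 1 N := by
  have := h.solution.smooth_eta.comp (contDiff_id.prodMk (contDiff_const (c := (0 : ℝ))))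
  simpa [Function.comp_def] using this

lemma contDiff_U (h : IsTravelingWave s ε δ ηp up N U) : ContDiff ℝ 3 U := by
  have := h.solution.smooth_u.comp (contDiff_id.prodMk (contDiff_const (c := (0 : ℝ))))
  simpa [Function.comp_def] using this

lemma hasDerivAt_N (h : IsTravelingWave s ε δ ηp up N U) (x : ℝ) :
    HasDerivAt N (deriv N x) x :=
  (h.contDiff_N.differentiable one_ne_zero x).hasDerivAt

lemma hasDerivAt_U (h : IsTravelingWave s ε δ ηp up N U) (x : ℝ) :
    HasDerivAt U (deriv U x) x :=
  (h.contDiff_U.differentiable (by norm_num) x).hasDerivAt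

lemma hasDerivAt_U' (h : IsTravelingWave s ε δ ηp up N U) (x : ℝ) :
    HasDerivAt (deriv U) (deriv (deriv U) x) x := by
  have h1 : ContDiff ℝ 2 (deriv U) :=
    (contDiff_succ_iff_deriv.1 (show ContDiff ℝ (2 + 1) U by
      have := h.contDiff_U; norm_num; exact this)).2.2
  exact (h1.differentiable (by norm_num) x).hasDerivAt

lemma hasDerivAt_U'' (h : IsTravelingWave s ε δ ηp up N U) (x : ℝ) :
    HasDerivAt (deriv (deriv U)) (deriv (deriv (deriv U)) x) x := by
  have h1 : ContDiff ℝ 2 (deriv U) :=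
    (contDiff_succ_iff_deriv.1 (show ContDiff ℝ (2 + 1) U by
      have := h.contDiff_U; norm_num; exact this)).2.2
  have h2 : ContDiff ℝ 1 (deriv (deriv U)) :=
    (contDiff_succ_iff_deriv.1 (show ContDiff ℝ (1 + 1) (deriv U) by
      norm_num; exact h1)).2.2
  exact (h2.differentiable one_ne_zero x).hasDerivAt

/-- The mass equation for the profiles. -/
lemma mass_ode (h : IsTravelingWave s ε δ ηp up N U) (x : ℝ) :
    -s * deriv N x + deriv U x + (deriv N x * U x + N x * deriv U x) = 0 := by
  have hm := h.solution.mass x 0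
  have h1 : HasDerivAt (fun t => x - s * t) (-s) 0 := by
    simpa using ((hasDerivAt_id (0 : ℝ)).const_mul s).const_sub x
  have h2 : HasDerivAt (fun t => N (x - s * t)) (deriv N x * -s) 0 :=
    HasDerivAt.comp (0 : ℝ) (by simpa using h.hasDerivAt_N x) h1
  have h3 : (fun y => U (y - s * 0)) = U := by simp
  have h4 : (fun y => N (y - s * 0) * U (y - s * 0)) = fun y => N y * U y := by simp
  simp only [h3, h4, h2.deriv] at hm
  rw [show (fun y => N y * U y) = N * U from rfl,
    ((h.hasDerivAt_N x).mul (h.hasDerivAt_U x)).deriv] at hm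
  linarith

/-- The momentum equation for the profiles. -/
lemma momentum_ode (h : IsTravelingWave s ε δ ηp up N U) (x : ℝ) :
    -s * deriv U x + deriv N x + U x * deriv U x + δ * s * deriv (deriv (deriv U)) x
      - ε * deriv (deriv U) x = 0 := by
  have hm := h.solution.momentum x 0
  have h1 : HasDerivAt (fun t => x - s * t) (-s) 0 := by
    simpa using ((hasDerivAt_id (0 : ℝ)).const_mul s).const_sub x
  have h2 : HasDerivAt (fun t => U (x - s * t)) (deriv U x * -s) 0 :=
    HasDerivAt.comp (0 : ℝ) (by simpa using h.hasDerivAt_U x) h1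
  have h3 : (fun y => U (y - s * 0)) = U := by simp
  have h4 : (fun y => N (y - s * 0)) = N := by simp
  have h5 : ∀ t, iteratedDeriv 2 (fun y => U (y - s * t)) x = deriv (deriv U) (x - s * t) := by
    intro t
    rw [iteratedDeriv_comp_sub_const]
    simp [iteratedDeriv_succ, iteratedDeriv_zero]
  have h6 : HasDerivAt (fun t => deriv (deriv U) (x - s * t))
      (deriv (deriv (deriv U)) x * -s) 0 := by
    have h7 : HasDerivAt (deriv (deriv U)) (deriv (deriv (deriv U)) x) (x - s * 0) := by
      rw [mul_zero, sub_zero]; exact h.hasDerivAt_U'' x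
    exact h7.comp 0 h1
  have h8 : iteratedDeriv 2 U x = deriv (deriv U) x := by
    simp [iteratedDeriv_succ, iteratedDeriv_zero]
  simp only [h5, h3, h4, h2.deriv, h6.deriv, h8] at hm
  simp only [mul_zero, sub_zero] at hm
  linarith

lemma mass_integral (h : IsTravelingWave s ε δ ηp up N U) (x : ℝ) : N x * (s - U x) = U x := by
  have hd : ∀ x, HasDerivAt (fun x => -s * N x + U x + N x * U x) 0 x := fun x =>
    ((((h.hasDerivAt_N x).const_mul (-s)).add (h.hasDerivAt_U x)).add
      ((h.hasDerivAt_N x).mul (h.hasDerivAt_U x))).congr_deriv (h.mass_ode x)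
  have hl := ((h.eta_ahead.const_mul (-s)).add h.u_ahead).add (h.eta_ahead.mul h.u_ahead)
  have := eq_const_of_hasDerivAt_zero hd hl x
  linarith

lemma U_lt (h : IsTravelingWave s ε δ ηp up N U) (hs : 1 < s) (x : ℝ) : U x < s := by
  by_contra hc
  obtain ⟨y, hy, hxy⟩ := ((h.u_ahead.eventually_lt_const (show (0 : ℝ) < s by linarith)).and
    (eventually_ge_atTop x)).exists
  obtain ⟨z, -, hz⟩ := intermediate_value_Icc' hxy h.contDiff_U.continuous.continuousOn
    (show s ∈ Set.Icc (U y) (U x) from ⟨hy.le, not_lt.1 hc⟩)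
  have := h.mass_integral z
  rw [hz] at this
  linarith

lemma N_eq (h : IsTravelingWave s ε δ ηp up N U) (hs : 1 < s) (x : ℝ) :
    N x = U x / (s - U x) := by
  have : s - U x ≠ 0 := by linarith [h.U_lt hs x]
  rw [eq_div_iff this, h.mass_integral x]

lemma momentum_first_integral (h : IsTravelingWave s ε δ ηp up N U) (hs : 1 < s) (hε : 0 < ε)
    (hδ : 0 < δ) (x : ℝ) :
    -s * U x + N x + U x ^ 2 / 2 + δ * s * deriv (deriv U) x - ε * deriv U x = 0 := by
  set F : ℝ → ℝ := fun x => -s * U x + N x + U x ^ 2 / 2 with hF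
  set G : ℝ → ℝ := fun x => F x + δ * s * deriv (deriv U) x - ε * deriv U x with hG
  have hd : ∀ x, HasDerivAt G 0 x := fun x => by
    refine (((((h.hasDerivAt_U x).const_mul (-s)).add (h.hasDerivAt_N x)).add
      (((h.hasDerivAt_U x).pow 2).div_const 2)).add
      ((h.hasDerivAt_U'' x).const_mul (δ * s)) |>.sub
      ((h.hasDerivAt_U' x).const_mul ε)).congr_deriv ?_
    rw [← h.momentum_ode x]
    norm_num
    ring
  have hconst : ∀ x y, G x = G y := fun x y =>
    is_const_of_deriv_eq_zero (fun x => (hd x).differentiableAt) (fun x => (hd x).deriv) x y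
  change G x = 0
  have hZ : ∀ y, HasDerivAt (fun y => δ * s * deriv U y - ε * U y) (G x - F y) y := fun y => by
    refine (((h.hasDerivAt_U' y).const_mul (δ * s)).sub
      ((h.hasDerivAt_U y).const_mul ε)).congr_deriv ?_
    rw [hconst x y, hG]
    ring
  have hlim : Tendsto F atTop (𝓝 0) := by
    have := ((h.u_ahead.const_mul (-s)).add h.eta_ahead).add ((h.u_ahead.pow 2).div_const 2)
    rwa [show -s * 0 + 0 + 0 ^ 2 / 2 = (0 : ℝ) by norm_num] at this
  refine eq_zero_of_near_const (ℓ := 0) (by positivity) hε.le h.hasDerivAt_U hZ fun θ hθ => ?_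
  obtain ⟨T, hT⟩ := eventually_atTop.1 ((Metric.tendsto_nhds.1 h.u_ahead θ hθ).and
    (Metric.tendsto_nhds.1 hlim θ hθ))
  refine ⟨T, fun y hy => ⟨(hT y hy.1).1, ?_⟩⟩
  have := (hT y hy.1).2
  rw [Real.dist_eq, sub_zero] at this
  rwa [show G x - F y - G x = -F y by ring, abs_neg]

/-- The state behind the wave is determined by the speed. -/
lemma state_behind (h : IsTravelingWave s ε δ ηp up N U) (hs : 1 < s) (hε : 0 < ε) (hδ : 0 < δ)
    (hne : (ηp, up) ≠ (0, 0)) : up = uPlus s ∧ ηp = etaPlus s := by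
  have hlim : ηp * (s - up) = up :=
    tendsto_nhds_unique ((h.eta_behind.mul (h.u_behind.const_sub s)).congr h.mass_integral)
      h.u_behind
  have hle : up ≤ s := le_of_tendsto h.u_behind (Eventually.of_forall fun x => (h.U_lt hs x).le)
  have hlt : up < s := by
    refine lt_of_le_of_ne hle fun e => ?_
    rw [e] at hlim
    linarith
  have hη : ηp = up / (s - up) := by
    have : s - up ≠ 0 := by linarith
    rw [eq_div_iff this, hlim]
  have hu0 : up ≠ 0 := fun e => hne (by rw [hη, e]; simp)
  set F : ℝ → ℝ := fun x => -s * U x + N x + U x ^ 2 / 2 with hF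
  have hFlim : Tendsto F atBot (𝓝 (-s * up + ηp + up ^ 2 / 2)) :=
    ((h.u_behind.const_mul (-s)).add h.eta_behind).add ((h.u_behind.pow 2).div_const 2)
  have hZ : ∀ y, HasDerivAt (fun y => δ * s * deriv U y - ε * U y) (-F y) y := fun y => by
    refine (((h.hasDerivAt_U' y).const_mul (δ * s)).sub
      ((h.hasDerivAt_U y).const_mul ε)).congr_deriv ?_
    have := h.momentum_first_integral hs hε hδ y
    simp only [hF]
    linarith
  have hzero : -(-s * up + ηp + up ^ 2 / 2) = 0 := by
    refine eq_zero_of_near_const (ℓ := up) (by positivity) hε.le h.hasDerivAt_U hZ fun θ hθ => ?_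
    obtain ⟨T, hT⟩ := eventually_atBot.1 ((Metric.tendsto_nhds.1 h.u_behind θ hθ).and
      (Metric.tendsto_nhds.1 hFlim.neg θ hθ))
    exact ⟨T - 3, fun y hy => hT y (by linarith [hy.2])⟩
  have hphi : phi s up = 0 := by
    rw [hη] at hzero
    unfold phi
    linarith
  have hup := ((phi_eq_zero_iff hs hlt).1 hphi).resolve_left hu0
  exact ⟨hup, by rw [hη, hup, etaPlus]⟩

lemma hasDerivAt_profile (h : IsTravelingWave s ε δ ηp up N U) (τ : ℝ) :
    HasDerivAt (profile s δ U) (-(√(s * δ) * deriv U (-(√(s * δ) * τ)))) τ := by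
  have h1 : HasDerivAt (fun τ => -(√(s * δ) * τ)) (-√(s * δ)) τ := 
    ((hasDerivAt_id τ).const_mul √(s * δ)).neg.congr_deriv (by ring)
  refine (HasDerivAt.comp τ (h.hasDerivAt_U _) h1).congr_deriv ?_
  ring

lemma deriv_profile (h : IsTravelingWave s ε δ ηp up N U) :
    deriv (profile s δ U) = fun τ => -(√(s * δ) * deriv U (-(√(s * δ) * τ))) :=
  funext fun τ => (h.hasDerivAt_profile τ).deriv

lemma isProfile (h : IsTravelingWave s ε δ ηp up N U) (hs : 1 < s) (hε : 0 < ε) (hδ : 0 < δ)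
    (hup : up = uPlus s) :
    IsProfile s (friction s ε δ) (profile s δ U) (deriv (profile s δ U)) := by
  have hsδ : 0 < s * δ := by positivity
  have hr : 0 < √(s * δ) := Real.sqrt_pos.2 hsδ
  refine ⟨div_pos hε hr, fun τ => h.U_lt hs _, fun τ => ?_, fun τ => ?_, ?_, ?_⟩
  · rw [h.deriv_profile]; exact h.hasDerivAt_profile τ
  · rw [h.deriv_profile]
    have h1 : HasDerivAt (fun τ => -(√(s * δ) * τ)) (-√(s * δ)) τ := 
      ((hasDerivAt_id τ).const_mul √(s * δ)).neg.congr_deriv (by ring)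
    refine (((HasDerivAt.comp τ (h.hasDerivAt_U' _) h1).const_mul √(s * δ)).neg).congr_deriv ?_
    have hode := h.momentum_first_integral hs hε hδ (-(√(s * δ) * τ))
    rw [h.N_eq hs] at hode
    have hsq : √(s * δ) * √(s * δ) = s * δ := Real.mul_self_sqrt hsδ.le
    have hcw : friction s ε δ * (-(√(s * δ) * deriv U (-(√(s * δ) * τ)))) =
        -(ε * deriv U (-(√(s * δ) * τ))) := by
      unfold friction
      field_simp
    rw [hcw]
    unfold phi profile
    set y := -(√(s * δ) * τ)
    have : -(√(s * δ) * (deriv (deriv U) y * -√(s * δ))) = s * δ * deriv (deriv U) y := by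
      linear_combination (deriv (deriv U) y) * hsq
    rw [this]
    linarith
  · refine h.u_ahead.comp (tendsto_neg_atBot_atTop.comp (tendsto_id.const_mul_atBot hr))
  · rw [← hup]
    exact h.u_behind.comp (tendsto_neg_atTop_atBot.comp (tendsto_id.const_mul_atTop hr))

end IsTravelingWave

/-! ### The limit shock -/

lemma etaPlus_pos {s : ℝ} (hs : 1 < s) : 0 < etaPlus s :=
  div_pos (uPlus_pos hs) (sub_pos.2 (uPlus_lt hs))

/-- The Rankine-Hugoniot condition of the mass equation. -/
lemma mass_jump {s : ℝ} (hs : 1 < s) : s * etaPlus s = uPlus s + etaPlus s * uPlus s := by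
  have : s - uPlus s ≠ 0 := by linarith [uPlus_lt hs]
  unfold etaPlus
  field_simp
  ring

/-- The Rankine-Hugoniot condition of the momentum equation. -/
lemma momentum_jump {s : ℝ} (hs : 1 < s) : s * uPlus s = etaPlus s + uPlus s ^ 2 / 2 := by
  have := (phi_eq_zero_iff hs (uPlus_lt hs)).2 (Or.inr rfl)
  unfold phi at this
  unfold etaPlus
  linarith

lemma isLaxShock {s : ℝ} (hs : 1 < s) : IsLaxShock s (etaPlus s) (uPlus s) 0 0 := by
  have h0 := uPlus_pos hs
  have hd0 : 0 < s - uPlus s := by linarith [uPlus_lt hs]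
  have hd1 := sub_uPlus_lt_one hs
  have hη := etaPlus_pos hs
  refine ⟨fun h => h0.ne' (Prod.ext_iff.1 h).2, by linarith, by norm_num, ?_, ?_, ?_, ?_, ?_⟩
  · linarith [mass_jump hs]
  · linarith [momentum_jump hs]
  · simpa using hs
  · have : s - uPlus s < √(1 + etaPlus s) := by
      have h1 : 1 < 1 + etaPlus s := by linarith
      exact hd1.trans (Real.lt_sqrt_of_sq_lt (by linarith))
    linarith
  · have := Real.sqrt_nonneg (1 + etaPlus s)
    linarith

lemma measurable_jump (s a b : ℝ) : Measurable fun p : ℝ × ℝ => jump s a b p.1 p.2 :=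
  Measurable.ite (measurableSet_lt measurable_fst (measurable_snd.const_mul s))
    measurable_const measurable_const

lemma abs_jump_le (s a x t : ℝ) : |jump s a 0 x t| ≤ |a| := by
  unfold jump
  split_ifs
  · exact le_rfl
  · simp

lemma locallyIntegrable_jump (s a : ℝ) :
    LocallyIntegrable fun p : ℝ × ℝ => jump s a 0 p.1 p.2 :=
  (locallyIntegrable_const |a|).mono (measurable_jump s a 0).aestronglyMeasurable
    (Eventually.of_forall fun p => by simpa using abs_jump_le s a p.1 p.2)

lemma jump_mul (s a b x t : ℝ) : jump s a 0 x t * jump s b 0 x t = jump s (a * b) 0 x t := by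
  unfold jump
  split_ifs <;> simp

/-- The jump is constant along the direction `(s, 1)` of its discontinuity, so its distributional
derivative in this direction vanishes. -/
lemma integral_jump_mul_fderiv (s a : ℝ) {ψ : ℝ × ℝ → ℝ} (hψ : ContDiff ℝ (⊤ : ℕ∞) ψ)
    (hsupp : HasCompactSupport ψ) :
    ∫ p : ℝ × ℝ, jump s a 0 p.1 p.2 * fderiv ℝ ψ p (s, 1) = 0 := by
  have hψ1 : ContDiff ℝ 1 ψ := hψ.of_le (by exact_mod_cast le_top)
  have hint : ∀ g : ℝ × ℝ → ℝ, Continuous g → HasCompactSupport g →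
      Integrable fun p : ℝ × ℝ => jump s a 0 p.1 p.2 * g p := fun g hg hgs =>
    (hg.integrable_of_hasCompactSupport hgs).bdd_mul (c := |a|)
      (measurable_jump s a 0).aestronglyMeasurable
      (Eventually.of_forall fun p => by simpa using abs_jump_le s a p.1 p.2)
  have hd : Continuous fun p => fderiv ℝ ψ p (s, 1) :=
    (hψ1.continuous_fderiv one_ne_zero).clm_apply continuous_const
  have hds : HasCompactSupport fun p => fderiv ℝ ψ p (s, 1) := hsupp.fderiv_apply ℝ (s, 1)
  have key := integral_bilinear_hasLineDerivAt_right_eq_neg_left_of_integrable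
    (μ := (volume : Measure (ℝ × ℝ))) (f := fun p : ℝ × ℝ => jump s a 0 p.1 p.2)
    (f' := fun _ => 0) (g := ψ) (g' := fun p => fderiv ℝ ψ p (s, 1)) (v := ((s, 1) : ℝ × ℝ))
    (B := ContinuousLinearMap.mul ℝ ℝ) (by simp)
    (by simpa using hint _ hd hds) (by simpa using hint ψ hψ1.continuous hsupp)
    (fun p _ => ?_) (fun p _ => ((hψ1.differentiable one_ne_zero p).hasFDerivAt).hasLineDerivAt _)
  · simpa using key
  · have : (fun t : ℝ => jump s a 0 (p + t • ((s, 1) : ℝ × ℝ)).1 (p + t • ((s, 1) : ℝ × ℝ)).2) =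
        fun _ => jump s a 0 p.1 p.2 := by
      funext t
      have e : p.1 + t * s < s * (p.2 + t) ↔ p.1 < s * p.2 := by
        constructor <;> intro h <;> linarith
      simp [jump, e]
    unfold HasLineDerivAt
    rw [this]
    exact hasDerivAt_const _ _

lemma isShallowWaterWeakSolution_jump {s : ℝ} (hs : 1 < s) :
    IsShallowWaterWeakSolution (jump s (etaPlus s) 0) (jump s (uPlus s) 0) := by
  have hfd : ∀ (ψ : ℝ × ℝ → ℝ) p, fderiv ℝ ψ p (s, 1) =
      s * fderiv ℝ ψ p (1, 0) + fderiv ℝ ψ p (0, 1) := fun ψ p => by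
    have : ((s, 1) : ℝ × ℝ) = s • ((1, 0) : ℝ × ℝ) + (0, 1) := by simp
    rw [this, map_add, map_smul, smul_eq_mul]
  refine ⟨(locallyIntegrable_jump _ _).locallyIntegrableOn _,
    (locallyIntegrable_jump _ _).locallyIntegrableOn _, ?_, ?_, ?_, ?_⟩
  · simp only [jump_mul]
    exact (locallyIntegrable_jump _ _).locallyIntegrableOn _
  · simp only [pow_two, jump_mul]
    exact (locallyIntegrable_jump _ _).locallyIntegrableOn _
  · intro ψ hψ hsupp _
    refine (integral_congr_ae (Eventually.of_forall fun p => ?_)).trans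
      (integral_jump_mul_fderiv s (etaPlus s) hψ hsupp)
    simp only [hfd]
    unfold jump
    split_ifs
    · rw [← mass_jump hs]; ring
    · ring
  · intro ψ hψ hsupp _
    refine (integral_congr_ae (Eventually.of_forall fun p => ?_)).trans
      (integral_jump_mul_fderiv s (uPlus s) hψ hsupp)
    simp only [hfd]
    unfold jump
    split_ifs
    · rw [← momentum_jump hs]; ring
    · ring

/-! ### Convergence to the shock -/

lemma volume_line (s : ℝ) : volume {q : ℝ × ℝ | q.1 - s * q.2 = 0} = 0 := by
  set f : ℝ × ℝ →ₗ[ℝ] ℝ := LinearMap.fst ℝ ℝ ℝ - s • LinearMap.snd ℝ ℝ ℝ with hf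
  have h1 : ({q : ℝ × ℝ | q.1 - s * q.2 = 0}) = (LinearMap.ker f : Set (ℝ × ℝ)) := by
    ext q
    simp [hf]
  rw [h1]
  refine Measure.addHaar_submodule _ _ fun htop => ?_
  have : ((1, 0) : ℝ × ℝ) ∈ LinearMap.ker f := htop ▸ Submodule.mem_top
  simp [hf] at this

/-- The strip of half-width `1 / (n + 1)` around the line `x = s t`. -/
def strip (s : ℝ) (n : ℕ) : Set (ℝ × ℝ) := {q | |q.1 - s * q.2| < 1 / ((n : ℝ) + 1)}

lemma measurableSet_strip (s : ℝ) (n : ℕ) : MeasurableSet (strip s n) :=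
  (isOpen_lt (by fun_prop) continuous_const).measurableSet

lemma tendsto_measure_strip (s : ℝ) {K : Set (ℝ × ℝ)} (hK : IsCompact K) :
    Tendsto (fun n => (volume.restrict K) (strip s n)) atTop (𝓝 0) := by
  have hanti : Antitone (strip s) := fun m n hmn q hq =>
    lt_of_lt_of_le (Set.mem_ofPred_eq ▸ hq) (Nat.one_div_le_one_div hmn)
  have h := tendsto_measure_iInter_atTop (μ := volume.restrict K) (s := strip s)
    (fun n => (measurableSet_strip s n).nullMeasurableSet) hanti
    ⟨0, ((measure_mono (Set.subset_univ _)).trans_lt (by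
      rw [Measure.restrict_apply_univ]; exact hK.measure_lt_top)).ne⟩
  have hsub : ⋂ n, strip s n ⊆ {q : ℝ × ℝ | q.1 - s * q.2 = 0} := fun q hq => by
    by_contra hne
    obtain ⟨n, hn⟩ := exists_nat_one_div_lt (abs_pos.2 hne)
    have := Set.mem_iInter.1 hq n
    exact absurd hn (not_lt.2 (le_of_lt this))
  have h0 : (volume.restrict K) (⋂ n, strip s n) = 0 :=
    le_antisymm ((measure_mono hsub).trans ((Measure.restrict_apply_le _ _).trans
      (volume_line s).le)) zero_le
  rwa [h0] at h

/-- Uniformly bounded functions which converge to a jump uniformly at any positive distance from the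
discontinuity converge also in `L^p` on compact sets: up to a small constant the difference is
dominated by a multiple of the indicator function of a thin strip. -/
lemma convergesToJump_of_uniform {ι : Type*} {l : Filter ι} {s a B : ℝ} {F : ι → ℝ → ℝ}
    (hB : ∀ i ξ, |F i ξ| ≤ B)
    (hF : ∀ r > 0, ∀ θ > 0, ∀ᶠ i in l, ∀ ξ, (r ≤ ξ → |F i ξ| < θ) ∧ (ξ ≤ -r → |F i ξ - a| < θ)) :
    ConvergesToJump l s a 0 F := by
  have hdist : ∀ r > 0, ∀ θ > 0, ∀ᶠ i in l, ∀ q : ℝ × ℝ, r ≤ |q.1 - s * q.2| →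
      |F i (q.1 - s * q.2) - jump s a 0 q.1 q.2| < θ := by
    intro r hr θ hθ
    filter_upwards [hF r hr θ hθ] with i hi q hq
    rcases le_abs.1 hq with h | h
    · have : ¬ q.1 < s * q.2 := by linarith
      rw [jump, if_neg this, sub_zero]
      exact (hi _).1 h
    · have : q.1 < s * q.2 := by linarith
      rw [jump, if_pos this]
      exact (hi _).2 (by linarith)
  refine ⟨fun r hr => ?_, fun p hp hp' K hK => ?_⟩
  · rw [Metric.tendstoUniformlyOn_iff]
    intro θ hθ
    filter_upwards [hdist r hr θ hθ] with i hi q hq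
    rw [dist_comm, Real.dist_eq]
    exact hi q hq
  have hp0 : p ≠ 0 := fun h => by simp [h] at hp
  set μ := (volume : Measure (ℝ × ℝ)).restrict K with hμ
  set b : ℕ → ℝ≥0∞ := fun n => ‖(1 : ℝ) / ((n : ℝ) + 1)‖ₑ * μ Set.univ ^ (1 / p.toReal) +
    ‖B + |a|‖ₑ * μ (strip s n) ^ (1 / p.toReal) with hb
  have hblim : Tendsto b atTop (𝓝 0) := by
    have hpos : 0 < 1 / p.toReal := one_div_pos.2 (ENNReal.toReal_pos hp0 hp')
    have h1 : Tendsto (fun n : ℕ => ‖(1 : ℝ) / ((n : ℝ) + 1)‖ₑ) atTop (𝓝 0) := by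
      have := (continuous_enorm.tendsto (0 : ℝ)).comp
        (tendsto_one_div_add_atTop_nhds_zero_nat (𝕜 := ℝ))
      simpa [Function.comp_def] using this
    have h2 : μ Set.univ ^ (1 / p.toReal) ≠ ⊤ := by
      refine ENNReal.rpow_ne_top_of_nonneg hpos.le ?_
      rw [hμ, Measure.restrict_apply_univ]
      exact hK.measure_lt_top.ne
    have h3 : Tendsto (fun n => μ (strip s n) ^ (1 / p.toReal)) atTop (𝓝 0) := by
      have := ((ENNReal.continuous_rpow_const (y := 1 / p.toReal)).tendsto 0).comp
        (tendsto_measure_strip s hK)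
      rwa [ENNReal.zero_rpow_of_pos hpos] at this
    have h4 := ENNReal.Tendsto.mul_const (b := μ Set.univ ^ (1 / p.toReal)) h1 (Or.inr h2)
    have h5 := ENNReal.Tendsto.const_mul (a := ‖B + |a|‖ₑ) h3 (Or.inr enorm_ne_top)
    simpa [hb] using h4.add h5
  rw [ENNReal.tendsto_nhds_zero]
  intro θ hθ
  obtain ⟨n, hn⟩ := (ENNReal.tendsto_nhds_zero.1 hblim θ hθ).exists
  have hn0 : (0 : ℝ) < 1 / ((n : ℝ) + 1) := by positivity
  filter_upwards [hdist _ hn0 _ hn0] with i hi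
  refine le_trans ?_ hn
  have hBa : 0 ≤ B + |a| := add_nonneg ((abs_nonneg _).trans (hB i 0)) (abs_nonneg _)
  calc eLpNorm (fun q : ℝ × ℝ => F i (q.1 - s * q.2) - jump s a 0 q.1 q.2) p μ
      ≤ eLpNorm ((fun _ => (1 : ℝ) / ((n : ℝ) + 1)) +
          (strip s n).indicator fun _ => B + |a|) p μ := by
        refine eLpNorm_mono_real fun q => ?_
        rw [Real.norm_eq_abs, Pi.add_apply]
        by_cases hq : q ∈ strip s n
        · rw [Set.indicator_of_mem hq]
          have h1 := abs_sub (F i (q.1 - s * q.2)) (jump s a 0 q.1 q.2)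
          have h2 := hB i (q.1 - s * q.2)
          have h3 := abs_jump_le s a q.1 q.2
          linarith
        · rw [Set.indicator_of_notMem hq, add_zero]
          exact (hi q (not_lt.1 hq)).le
    _ ≤ eLpNorm (fun _ => (1 : ℝ) / ((n : ℝ) + 1)) p μ +
        eLpNorm ((strip s n).indicator fun _ => B + |a|) p μ :=
        eLpNorm_add_le aestronglyMeasurable_const
          (aestronglyMeasurable_const.indicator (measurableSet_strip s n)) hp
    _ = b n := by
        rw [eLpNorm_const' _ hp0 hp', eLpNorm_indicator_const (measurableSet_strip s n) hp0 hp']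

/-- In the variable `ξ = x - s t` the transition described by `NearJump` has a width of order
`√(s δ) (c + 1 / c) = ε + s δ / ε`, which tends to zero. -/
lemma convergesToJump_of_nearJump {ι : Type*} {l : Filter ι} {s : ℝ} (hs : 1 < s) {ε δ : ι → ℝ}
    {N U : ι → ℝ → ℝ} (hε : ∀ i, 0 < ε i) (hδ : ∀ i, 0 < δ i) (hε0 : Tendsto ε l (𝓝 0))
    (hδε : Asymptotics.IsLittleO l δ ε)
    (hwave : ∀ i, IsTravelingWave s (ε i) (δ i) (etaPlus s) (uPlus s) (N i) (U i)) {t : ι → ℝ}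
    (hnear : ∀ θ > 0, ∃ C, ∀ i,
      NearJump s θ C (friction s (ε i) (δ i)) (profile s (δ i) (U i)) (t i)) :
    ConvergesToJump l s (etaPlus s) 0 (fun i ξ => N i (ξ + -(√(s * δ i) * t i))) ∧
      ConvergesToJump l s (uPlus s) 0 (fun i ξ => U i (ξ + -(√(s * δ i) * t i))) := by
  obtain ⟨us, hus, hW⟩ := exists_isWell hs
  have hs0 : 0 < s := by linarith
  have hprof := fun i => (hwave i).isProfile hs (hε i) (hδ i) rfl
  have hr : ∀ i, 0 < √(s * δ i) := fun i => Real.sqrt_pos.2 (mul_pos hs0 (hδ i))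
  have hU : ∀ i ξ, U i ξ ∈ Set.Icc 0 us := fun i ξ => by
    have := (hprof i).mem_Icc hs hW (-(ξ / √(s * δ i)))
    have e : profile s (δ i) (U i) (-(ξ / √(s * δ i))) = U i ξ := by
      unfold profile
      congr 1
      have := (hr i).ne'
      field_simp
    rwa [e] at this
  have hwidth : Tendsto (fun i => √(s * δ i) *
      (friction s (ε i) (δ i) + 1 / friction s (ε i) (δ i))) l (𝓝 0) := by
    have h1 : ∀ i, √(s * δ i) * (friction s (ε i) (δ i) + 1 / friction s (ε i) (δ i)) =
        ε i + s * (δ i / ε i) := fun i => by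
      have h2 := (hr i).ne'
      have h3 := (hε i).ne'
      have h4 : √(s * δ i) ^ 2 = s * δ i := Real.sq_sqrt (mul_pos hs0 (hδ i)).le
      unfold friction
      field_simp
      rw [h4]
    simp only [h1]
    simpa using hε0.add (hδε.tendsto_div_nhds_zero.const_mul s)
  have hlocal : ∀ r > 0, ∀ θ > 0, ∀ᶠ i in l, ∀ ξ,
      (r ≤ ξ → |U i (ξ + -(√(s * δ i) * t i)) - 0| < θ) ∧
      (ξ ≤ -r → |U i (ξ + -(√(s * δ i) * t i)) - uPlus s| < θ) := by
    intro r hr0 θ hθ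
    obtain ⟨C, hC⟩ := hnear θ hθ
    have h1 := hwidth.const_mul C
    rw [mul_zero] at h1
    filter_upwards [h1.eventually_lt_const hr0] with i hi ξ
    have hri := hr i
    have e : U i (ξ + -(√(s * δ i) * t i)) =
        profile s (δ i) (U i) (t i - ξ / √(s * δ i)) := by
      unfold profile
      congr 1
      field_simp
      ring
    set c := friction s (ε i) (δ i)
    have hCr : C * (c + 1 / c) < r / √(s * δ i) := by
      rw [lt_div_iff₀ hri]
      linarith
    constructor
    · intro hξ
      have : r / √(s * δ i) ≤ ξ / √(s * δ i) := by gcongr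
      rw [sub_zero, abs_of_nonneg (hU i _).1, e]
      exact (hC i _).1 (by linarith)
    · intro hξ
      have : r / √(s * δ i) ≤ -ξ / √(s * δ i) := by
        gcongr
        linarith
      rw [neg_div] at this
      rw [e]
      exact (hC i _).2 (by linarith)
  -- both components are continuous functions of `U`
  have hcomp : ∀ (g : ℝ → ℝ) (B : ℝ), ContinuousAt g 0 → ContinuousAt g (uPlus s) → g 0 = 0 →
      (∀ u ∈ Set.Icc 0 us, |g u| ≤ B) →
      ConvergesToJump l s (g (uPlus s)) 0 (fun i ξ => g (U i (ξ + -(√(s * δ i) * t i)))) := by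
    intro g B hg0 hgu hzero hB
    refine convergesToJump_of_uniform (fun i ξ => hB _ (hU i _)) fun r hr0 θ hθ => ?_
    obtain ⟨θ₁, hθ₁, h1⟩ := Metric.continuousAt_iff.1 hg0 θ hθ
    obtain ⟨θ₂, hθ₂, h2⟩ := Metric.continuousAt_iff.1 hgu θ hθ
    filter_upwards [hlocal r hr0 θ₁ hθ₁, hlocal r hr0 θ₂ hθ₂] with i hi₁ hi₂ ξ
    refine ⟨fun hξ => ?_, fun hξ => h2 ((hi₂ ξ).2 hξ)⟩
    have := h1 ((hi₁ ξ).1 hξ)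
    rwa [hzero, Real.dist_eq, sub_zero] at this
  refine ⟨?_, ?_⟩
  · have hN : (fun i ξ => N i (ξ + -(√(s * δ i) * t i))) =
        fun i ξ => (fun u => u / (s - u)) (U i (ξ + -(√(s * δ i) * t i))) := by
      funext i ξ
      exact (hwave i).N_eq hs _
    have hcont : ∀ u < s, ContinuousAt (fun u => u / (s - u)) u := fun u hu =>
      continuousAt_id.div (continuousAt_const.sub continuousAt_id) (sub_pos.2 hu).ne'
    rw [hN]
    refine hcomp (fun u => u / (s - u)) (us / (s - us)) (hcont 0 hs0) (hcont _ (uPlus_lt hs))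
      (by simp) fun u hu => ?_
    have h1 : 0 < s - us := sub_pos.2 hus
    have h2 : 0 < s - u := by linarith [hu.2]
    rw [abs_of_nonneg (div_nonneg hu.1 h2.le)]
    have := hu.2
    exact div_le_div₀ (hu.1.trans hu.2) this h1 (by linarith)
  · exact hcomp id us continuousAt_id continuousAt_id rfl fun u hu => by
      rw [id, abs_of_nonneg hu.1]; exact hu.2

/-! ### Length of the oscillations and convergence -/

lemma friction_sq {s ε δ : ℝ} (hs : 1 < s) (hδ : 0 < δ) :
    friction s ε δ ^ 2 = ε ^ 2 / (s * δ) := by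
  unfold friction
  rw [div_pow, Real.sq_sqrt (by positivity)]

lemma exists_length_of_oscillations {s : ℝ} (hs : 1 < s) {e : ℝ} (he0 : 0 < e)
    (he : e < wellPotential s 0) :
    ∃ C κ : ℝ, 0 < C ∧ 0 < κ ∧ ∀ {c : ℝ} {v w : ℝ → ℝ}, IsProfile s c v w →
      c ^ 2 < 4 * alpha s → w 0 = 0 → ∃ T : ℝ, 0 ≤ T ∧ T ≤ C / c ∧
        (∀ τ, 0 < τ → τ < T → e < w τ ^ 2 / 2 + wellPotential s (v τ) ∧
          w τ ^ 2 / 2 + wellPotential s (v τ) < wellPotential s 0) ∧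
        (∀ τ, T < τ → 0 < w τ ^ 2 / 2 + wellPotential s (v τ) ∧
          w τ ^ 2 / 2 + wellPotential s (v τ) < e ∧
          w τ ^ 2 / 2 + wellPotential s (v τ) ≤ C * Real.exp (-(κ * c * (τ - T)))) := by
  have hup := uPlus_pos hs
  have hα := alpha_pos hs
  have hk : 0 < min 1 ((uPlus s - uPlus s / 2) / 2) / 2 * (uPlus s / 2) ^ 2 := by
    have : 0 < (uPlus s - uPlus s / 2) / 2 := by linarith
    positivity
  obtain ⟨C₁, hC₁, hdur⟩ := exists_duration_bound hs he0 hk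
  obtain ⟨C₂, κ, hC₂, hκ, hdec⟩ := exists_decay hs he0 he (show 0 < 1 + 4 * alpha s by positivity)
  refine ⟨max (C₁ * (1 + 4 * alpha s)) C₂, κ, by positivity, hκ, ?_⟩
  intro c v w h hcα hw0
  have hc := h.pos_c
  have hcc : c ≤ 1 + 4 * alpha s := by nlinarith [sq_nonneg (c - 1)]
  have hD := h.strictMono_deficit hs
  have hexists : ∃ T, 0 ≤ T ∧ w T ^ 2 / 2 + wellPotential s (v T) ≤ e ∧
      (0 < T → w T ^ 2 / 2 + wellPotential s (v T) = e) := by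
    rcases le_or_gt (w 0 ^ 2 / 2 + wellPotential s (v 0)) e with h0 | h0
    · exact ⟨0, le_rfl, h0, fun h => absurd h (lt_irrefl _)⟩
    · have hlim : Tendsto (fun t => w t ^ 2 / 2 + wellPotential s (v t)) atTop (𝓝 0) := by
        have := (h.deficit_top hs).const_sub (wellPotential s 0)
        rw [sub_self] at this
        refine this.congr fun t => ?_
        unfold deficit
        ring
      have hcont : Continuous fun t => w t ^ 2 / 2 + wellPotential s (v t) :=
        ((h.continuous_w.pow 2).div_const 2).add
          (continuous_iff_continuousAt.2 fun t => (h.hasDerivAt_potential hs t).continuousAt)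
      obtain ⟨t, ht, ht0⟩ := ((hlim.eventually_lt_const he0).and (eventually_ge_atTop 0)).exists
      obtain ⟨T, hT, hTe⟩ := intermediate_value_Icc' ht0 hcont.continuousOn
        (show e ∈ Set.Icc _ _ from ⟨ht.le, h0.le⟩)
      exact ⟨T, hT.1, hTe.le, fun _ => hTe⟩
  obtain ⟨T, hT0, hTe, hTe'⟩ := hexists
  refine ⟨T, hT0, ?_, fun τ hτ hτT => ⟨?_, ?_⟩, fun τ hτ => ⟨?_, ?_, ?_⟩⟩
  · rcases hT0.eq_or_lt with h0 | h0
    · rw [← h0]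
      positivity
    · have h1 := hdur h hT0 (h.deficit_of_critical hs hw0) (hTe' h0).ge
      have h2 : c + 1 / c ≤ (1 + 4 * alpha s) / c := by
        rw [le_div_iff₀ hc]
        have : (c + 1 / c) * c = c ^ 2 + 1 := by field_simp
        linarith
      calc T = T - 0 := by ring
        _ ≤ C₁ * (c + 1 / c) := h1
        _ ≤ C₁ * ((1 + 4 * alpha s) / c) := by gcongr
        _ = C₁ * (1 + 4 * alpha s) / c := by ring
        _ ≤ _ := by
            gcongr
            exact le_max_left _ _
  · have h1 := hD hτT
    have h2 := hTe' (hτ.trans hτT)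
    unfold deficit at h1
    linarith
  · have := h.deficit_pos hs τ
    unfold deficit at this
    linarith
  · have := h.deficit_lt hs τ
    unfold deficit at this
    linarith
  · have h1 := hD hτ
    unfold deficit at h1
    linarith
  · refine (hdec h hcc hTe hτ.le).trans ?_
    gcongr
    exact le_max_right _ _

end

end PeregrineBoussinesq

open PeregrineBoussinesq in
theorem mainTheorem5 (s : ℝ) (hs : 1 < s) :
    -- the potential well of the reduced equation, and the critical friction
    (∃ us, us < s ∧ IsWell (phi s) 0 (uPlus s) us) ∧
    alpha s = deriv (phi s) (uPlus s) ∧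
    -- the reduction of traveling waves to a second order equation
    (∀ ε δ ηp up : ℝ, ∀ N U : ℝ → ℝ, 0 < ε → 0 < δ → (ηp, up) ≠ (0, 0) →
      IsTravelingWave s ε δ ηp up N U →
        up = uPlus s ∧ ηp = etaPlus s ∧
        (∀ ξ, U ξ < s ∧ N ξ = U ξ / (s - U ξ)) ∧
        ∀ τ, iteratedDeriv 2 (profile s δ U) τ + friction s ε δ * deriv (profile s δ U) τ
          + phi s (profile s δ U τ) = 0) ∧
    -- the length of the oscillatory tail in the undular bore regime
    (∀ Em : ℝ, 0 < Em → Em < potential (phi s) (uPlus s) 0 →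
      ∃ C κ : ℝ, 0 < C ∧ 0 < κ ∧ ∀ ε δ : ℝ, ∀ N U : ℝ → ℝ, 0 < ε → 0 < δ →
        ε ^ 2 < 4 * δ * s * alpha s →
        IsTravelingWave s ε δ (etaPlus s) (uPlus s) N U → deriv U 0 = 0 →
        ∃ T : ℝ, 0 ≤ T ∧ T ≤ C / friction s ε δ ∧
          (∀ τ, 0 < τ → τ < T → Em < energy s (profile s δ U) τ ∧
            energy s (profile s δ U) τ < potential (phi s) (uPlus s) 0) ∧
          (∀ τ, T < τ → 0 < energy s (profile s δ U) τ ∧ energy s (profile s δ U) τ < Em ∧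
            energy s (profile s δ U) τ ≤ C * Real.exp (-(κ * friction s ε δ * (τ - T))))) ∧
    -- the limit is an admissible shock of the shallow-water equations
    IsLaxShock s (etaPlus s) (uPlus s) 0 0 ∧
    IsShallowWaterWeakSolution (jump s (etaPlus s) 0) (jump s (uPlus s) 0) ∧
    -- convergence as `ε, δ → 0` with `δ = o(ε)`
    (∀ (ι : Type*) (l : Filter ι) (ε δ : ι → ℝ) (N U : ι → ℝ → ℝ),
      (∀ i, 0 < ε i) → (∀ i, 0 < δ i) →
      Filter.Tendsto ε l (nhds 0) → Filter.Tendsto δ l (nhds 0) → Asymptotics.IsLittleO l δ ε →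
      (∀ i, IsTravelingWave s (ε i) (δ i) (etaPlus s) (uPlus s) (N i) (U i)) →
      -- in all regimes, with the front of the waves placed at the shock
      (∀ m : ℝ, 0 < m → m < uPlus s →
        ∃ h : ι → ℝ, (∀ i, U i (h i) = m ∧ ∀ ξ, h i < ξ → U i ξ < m) ∧
          ConvergesToJump l s (etaPlus s) 0 (fun i ξ => N i (ξ + h i)) ∧
          ConvergesToJump l s (uPlus s) 0 (fun i ξ => U i (ξ + h i))) ∧
      -- for undular bores, also with the crest of the waves placed at the shock
      (∀ q : ℝ, q < 1 → (∀ i, ε i ^ 2 ≤ q * (4 * δ i * s * alpha s)) →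
        ∃ h : ι → ℝ, (∀ i ξ, ξ ≠ h i → U i ξ < U i (h i)) ∧
          ConvergesToJump l s (etaPlus s) 0 (fun i ξ => N i (ξ + h i)) ∧
          ConvergesToJump l s (uPlus s) 0 (fun i ξ => U i (ξ + h i)))) := by
  have hs0 : 0 < s := by linarith
  refine ⟨exists_isWell hs, alpha_eq_deriv hs, ?_, ?_, isLaxShock hs,
    isShallowWaterWeakSolution_jump hs, ?_⟩
  · intro ε δ ηp up N U hε hδ hne h
    obtain ⟨hup, hηp⟩ := h.state_behind hs hε hδ hne
    refine ⟨hup, hηp, fun ξ => ⟨h.U_lt hs ξ, h.N_eq hs ξ⟩, fun τ => ?_⟩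
    rw [iteratedDeriv_succ, iteratedDeriv_one, ((h.isProfile hs hε hδ hup).hw τ).deriv]
    ring
  · intro Em hEm0 hEm
    obtain ⟨C, κ, hC, hκ, hlen⟩ := exists_length_of_oscillations hs hEm0 hEm
    refine ⟨C, κ, hC, hκ, ?_⟩
    intro ε δ N U hε hδ hεδ h hU
    refine hlen (h.isProfile hs hε hδ rfl) ?_ ?_
    · rw [friction_sq hs hδ, div_lt_iff₀ (by positivity)]
      linarith
    · rw [h.deriv_profile]
      simp [hU]
  · intro ι l ε δ N U hε hδ hε0 _ hδε hwave
    have hprof := fun i => (hwave i).isProfile hs (hε i) (hδ i) rfl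
    have hr : ∀ i, 0 < √(s * δ i) := fun i => Real.sqrt_pos.2 (mul_pos hs0 (hδ i))
    have hU : ∀ i ξ, U i ξ = profile s (δ i) (U i) (-(ξ / √(s * δ i))) := fun i ξ => by
      unfold profile
      congr 1
      have := (hr i).ne'
      field_simp
    refine ⟨fun m hm hm' => ?_, fun q hq hεq => ?_⟩
    · choose t ht hlt using fun i => (hprof i).exists_first_of_lt hm hm'
      refine ⟨fun i => -(√(s * δ i) * t i), fun i => ⟨ht i, fun ξ hξ => ?_⟩,
        convergesToJump_of_nearJump hs hε hδ hε0 hδε hwave fun θ hθ => ?_⟩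
      · rw [hU]
        refine hlt i _ ?_
        rw [neg_lt, lt_div_iff₀ (hr i)]
        linarith
      · obtain ⟨C, -, hC⟩ := exists_nearJump_front hs hm hm' hθ
        exact ⟨C, fun i => hC (hprof i) (ht i) (hlt i)⟩
    · have hcq : ∀ i, friction s (ε i) (δ i) ^ 2 ≤ 4 * (q * alpha s) := fun i => by
        rw [friction_sq hs (hδ i), div_le_iff₀ (mul_pos hs0 (hδ i))]
        linarith [hεq i]
      have hqα : q * alpha s < 1 * alpha s := by
        have := alpha_pos hs
        gcongr
      choose t ht using fun i => (hprof i).exists_crest hs (by linarith [hcq i])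
      refine ⟨fun i => -(√(s * δ i) * t i), fun i ξ hξ => ?_,
        convergesToJump_of_nearJump hs hε hδ hε0 hδε hwave fun θ hθ => ?_⟩
      · rw [hU i ξ]
        refine ht i _ fun heq => hξ ?_
        change ξ = -(√(s * δ i) * t i)
        rw [← heq]
        have := (hr i).ne'
        field_simp
      · obtain ⟨C, -, hC⟩ := exists_nearJump_crest hs hq hθ
        exact ⟨C, fun i => hC (hprof i) (hcq i) (ht i)⟩
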